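/- Let $\mathfrak g$ be a simple finite-dimensional Lie algebra over $\mathbb C$, $\mathfrak h$ a Cartan subalgebra, $n=\dim\mathfrak h$ its rank, $\alpha_1,\dots,\alpha_n$ a base of simple roots, $R^+$ the set of positive roots, and $\mathfrak n=\bigoplus_{\alpha\in R^+}\mathfrak g_\alpha$ the corresponding maximal nilpotent subalgebra. Let $(e_\alpha)_{\alpha\in R^+}$ be a basis of $\mathfrak n$ with $e_\alpha\in\mathfrak g_\alpha$ (for example, taken from a Chevalley basis), and $(f^\alpha)$ the dual basis; $x\otimes f$ denotes the $1$-cochain $z\mapsto f(z)x$. For a weight $\chi\in\mathfrak h^*$ write $\chi=\sum_i A_i(\chi)\alpha_i$. Let $\mu$ be the maximal root, and for $i=1,\dots,n$ put $$m_i=\max\{m\in\mathbb Z_{\ge0}\mid \mu-k\alpha_i\in R^+\text{ for all }k=0,1,\dots,m\},\qquad \gamma_i=\mu-m_i\alpha_i\in R^+.$$ Let $H^1=H^1(\mathfrak n;\mathfrak n)=Z^1/B^1$, where $Z^1\subset C^1=\operatorname{End}(\mathfrak n)$ is the space of $1$-cocycles and $B^1=\{[\,\cdot\,,x] : x\in\mathfrak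 n\}$ that of coboundaries. Let $\mathfrak l_0=\Pi(H^1)$ be the Lie algebra $H^1$ with the bracket induced by the Nijenhuis bracket, which on $C^1$ is determined by bilinearity and $$[x\otimes f,\,y\otimes g]=f(y)\,x\otimes g-g(x)\,y\otimes f,$$ i.e. is the commutator of endomorphisms. Say that a cochain $b\in C^1$ has weight $w\in\mathfrak h^*$ if $b(\mathfrak g_\alpha)\subset\mathfrak g_{\alpha+w}$ for all $\alpha\in R^+$, and put $w_i(b)=A_i(w)$ if $b\neq 0$ has weight $w$. **Theorem.** If $\mathfrak g\not\cong\mathfrak{sl}(2)$, then $\dim H^1=2n$, and the cochains $$c_i=\sum_{\alpha\in R^+}A_i(\alpha)\,e_\alpha\otimes f^\alpha,\qquad b_i=e_{\gamma_i}\otimes f^{\alpha_i}\qquad(i=1,\dots,n)$$ are cocycles whose classes form a basis of $H^1$. The cochain $b_j$ has weight $\gamma_j-\alpha_j$. If moreover $\mathfrak g\not\cong\mathfrak{sl}(3)$, then in $\mathfrak l_0$, for all $i,j=1,\dots,n$, $$[c_i,c_j]=[b_i,b_j]=0,\qquad [c_i,b_j]=w_i(b_j)\,b_j,$$ where $w_i(b_j)=A_i(\gamma_j-\alpha_j)$.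 -/

import Mathlib

open LieAlgebra Module

noncomputable section

attribute [local instance 100] LieRing.ofAssociativeRing

/-! ### First cohomology of a Lie algebra with adjoint coefficients -/

namespace AdjointCohomology

variable (R L : Type*) [CommRing R] [LieRing L] [LieAlgebra R L]

/-- The space `C¹(L; L)` of 1-cochains. Its Lie bracket is the commutator of endomorphisms; on the
elementary cochains `x ⊗ φ : z ↦ φ z • x` this is
`[x ⊗ φ, y ⊗ ψ] = φ y • (x ⊗ ψ) - ψ x • (y ⊗ φ)`, that is, the Nijenhuis bracket on the
degree-zero part of `Π(C^{•+1}(L; L))`. -/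
abbrev C1 := Module.End R L

variable {R L} in
/-- The bracket of two elementary cochains. -/
lemma lie_smulRight (x y : L) (φ ψ : L →ₗ[R] R) :
    ⁅(φ.smulRight x : C1 R L), (ψ.smulRight y : C1 R L)⁆ =
      φ y • ψ.smulRight x - ψ x • φ.smulRight y := by
  ext z
  change φ (ψ z • y) • x - ψ (φ z • x) • y = φ y • (ψ z • x) - ψ x • (φ z • y)
  simp only [map_smul, smul_eq_mul, smul_smul, mul_comm]

/-- The differential `C⁰(L; L) → C¹(L; L)`, `(d m) x = ⁅x, m⁆`. -/
def d₀₁ : L →ₗ[R] C1 R L where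
  toFun m :=
    { toFun := fun x => ⁅x, m⁆
      map_add' := fun x y => add_lie x y m
      map_smul' := fun t x => smul_lie t x m }
  map_add' m m' := by ext x; simp
  map_smul' t m := by ext x; simp

/-- The 1-cocycles `Z¹(L; L)`, i.e. the kernel of the differential `C¹ → C²`; they form a Lie
subalgebra of `C¹(L; L)`. -/
def Z1 : LieSubalgebra R (C1 R L) where
  __ := LinearMap.ker (LieModule.Cohomology.d₁₂ R L L)
  lie_mem' {f g} hf hg := by
    have key : ∀ h : C1 R L, LieModule.Cohomology.d₁₂ R L L h = 0 →
        ∀ x y, h ⁅x, y⁆ = ⁅x, h y⁆ - ⁅y, h x⁆ := by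
      intro h hh x y
      have := LieModule.Cohomology.d₁₂_apply_apply R L L h x y
      rw [hh] at this
      exact (sub_eq_zero.mp this.symm).symm
    have hf' := key f hf
    have hg' := key g hg
    change LieModule.Cohomology.d₁₂ R L L ⁅f, g⁆ = 0
    ext x y
    change ⁅x, f (g y) - g (f y)⁆ - ⁅y, f (g x) - g (f x)⁆ - (f (g ⁅x, y⁆) - g (f ⁅x, y⁆)) = 0
    rw [hf', hg', map_sub, map_sub, hf', hf', hg', hg', lie_sub, lie_sub]
    abel_nf
    rw [← lie_skew (f x) (g y), ← lie_skew (f y) (g x)]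
    abel

/-- The 1-coboundaries `B¹(L; L)`, i.e. the image of the differential `C⁰ → C¹`; they form an ideal
of the Lie algebra of 1-cocycles. -/
def B1 : LieIdeal R (Z1 R L) where
  __ := (LinearMap.range (d₀₁ R L)).comap (Z1 R L).toSubmodule.subtype
  lie_mem {f c} hc := by
    obtain ⟨m, hm⟩ := hc
    refine ⟨(f : C1 R L) m, ?_⟩
    have hm' : (c : C1 R L) = d₀₁ R L m := hm.symm
    have hf : LieModule.Cohomology.d₁₂ R L L f = 0 := f.2
    ext x
    have h := LieModule.Cohomology.d₁₂_apply_apply R L L f x m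
    rw [hf] at h
    have h' := (sub_eq_zero.mp h.symm).symm
    change ⁅x, (f : C1 R L) m⁆ = (f : C1 R L) ((c : C1 R L) x) - (c : C1 R L) ((f : C1 R L) x)
    rw [hm']
    change ⁅x, (f : C1 R L) m⁆ = (f : C1 R L) ⁅x, m⁆ - ⁅(f : C1 R L) x, m⁆
    rw [h', ← lie_skew ((f : C1 R L) x) m]
    abel

/-- The first cohomology `H¹(L; L) = Z¹(L; L) / B¹(L; L)`, with the Lie bracket induced from
`C¹(L; L)`. -/
abbrev H1 := Z1 R L ⧸ B1 R L

variable {R L}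

/-- The cohomology class of a 1-cocycle. -/
def cls (f : C1 R L) (hf : f ∈ Z1 R L) : H1 R L :=
  LieSubmodule.Quotient.mk (N := B1 R L) (⟨f, hf⟩ : Z1 R L)

end AdjointCohomology

/-! ### The maximal nilpotent subalgebra spanned by the positive root vectors -/

namespace MaxNilpotent

variable {𝔤 : Type*} [LieRing 𝔤] [LieAlgebra ℂ 𝔤] [FiniteDimensional ℂ 𝔤] [IsSimple ℂ 𝔤]
  {H : LieSubalgebra ℂ 𝔤} [H.IsCartanSubalgebra]

/-- The set `R⁺` of positive roots relative to a base (a choice of simple roots). -/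
abbrev PosRoot (b : (IsKilling.rootSystem H).Base) := {α : H.root // b.IsPos α}

instance (b : (IsKilling.rootSystem H).Base) : Fintype (PosRoot b) := Fintype.ofFinite _

/-- A positive root as a linear form on the Cartan subalgebra. -/
def PosRoot.wt {b : (IsKilling.rootSystem H).Base} (α : PosRoot b) : Dual ℂ H :=
  (IsKilling.rootSystem H).root α.1

/-- The simple roots as positive roots. -/
def simpleRoot (b : (IsKilling.rootSystem H).Base) (i : b.support) : PosRoot b :=
  ⟨i, RootPairing.Base.isPos_of_mem_support i.2⟩

/-- The maximal nilpotent subalgebra `𝔫 = ⨁_{α ∈ R⁺} 𝔤_α`. -/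
def nilp (b : (IsKilling.rootSystem H).Base) : LieSubalgebra ℂ 𝔤 where
  __ := ⨆ α : PosRoot b, (rootSpace H α.wt).toSubmodule
  lie_mem' {x y} hx hy := by
    change ⁅x, y⁆ ∈ ⨆ α : PosRoot b, (rootSpace H α.wt).toSubmodule
    change x ∈ ⨆ α : PosRoot b, (rootSpace H α.wt).toSubmodule at hx
    change y ∈ ⨆ α : PosRoot b, (rootSpace H α.wt).toSubmodule at hy
    induction hx using Submodule.iSup_induction' with
    | zero => simp
    | add u v _ _ hu hv => rw [add_lie]; exact add_mem hu hv
    | mem α u hu =>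
      induction hy using Submodule.iSup_induction' with
      | zero => simp
      | add v w _ _ hv hw => rw [lie_add]; exact add_mem hv hw
      | mem β v hv =>
        have h : ⁅u, v⁆ ∈ rootSpace H (α.wt + β.wt : H → ℂ) :=
          lie_mem_genWeightSpace_of_mem_genWeightSpace hu hv
        by_cases hbot : rootSpace H (α.wt + β.wt : H → ℂ) = ⊥
        · rw [hbot, LieSubmodule.mem_bot] at h
          rw [h]; exact zero_mem _
        · let γ : LieModule.Weight ℂ H 𝔤 := ⟨α.wt + β.wt, hbot⟩
          have hγ : γ ∈ H.root := by
            have h0 : α.wt + β.wt ≠ 0 := by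
              let _ := (IsKilling.rootSystem H).indexNeg
              intro h0
              have hβ : β.1 = -α.1 := by
                apply (IsKilling.rootSystem H).root.injective
                rw [RootPairing.indexNeg_neg, RootPairing.root_reflectionPerm, RootPairing.reflection_apply_self]
                exact eq_neg_of_add_eq_zero_right h0
              exact (RootPairing.Base.IsPos.neg_iff_not b α.1).mp (hβ ▸ β.2) α.2
            rw [LieSubalgebra.root, Finset.mem_filter]
            refine ⟨Finset.mem_univ _, fun hz => h0 ?_⟩
            ext z
            exact congrFun hz z
          have hs : (IsKilling.rootSystem H).root ⟨γ, hγ⟩ =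
              (IsKilling.rootSystem H).root α.1 + (IsKilling.rootSystem H).root β.1 := by
            ext z; rfl
          exact Submodule.mem_iSup_of_mem (⟨⟨γ, hγ⟩, α.2.add β.2 hs⟩ : PosRoot b) h

/-- The coordinate `A_i(χ)` of a weight `χ = ∑ i, A_i(χ) α_i` relative to the simple roots. -/
def A (b : (IsKilling.rootSystem H).Base) (i : b.support) (χ : Dual ℂ H) : ℂ :=
  b.toWeightBasis.repr χ i

/-- `μ` is maximal for the usual partial order on roots: no other positive root exceeds `μ` by a
sum of simple roots. -/
def IsMaximalRoot (b : (IsKilling.rootSystem H).Base) (μ : PosRoot b) : Prop :=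
  ∀ β : PosRoot b,
    β.wt - μ.wt ∈ AddSubmonoid.closure (Set.range fun i => (simpleRoot b i).wt) → β = μ

/-- The set of all `m` such that `μ - k α_i` is a positive root for `k = 0, 1, …, m`. -/
def stringSet {b : (IsKilling.rootSystem H).Base} (μ : PosRoot b) (i : b.support) : Set ℕ :=
  {m | ∀ k ≤ m, ∃ β : PosRoot b, β.wt = μ.wt - k • (simpleRoot b i).wt}

/-- `m_i = max {m | μ - k α_i ∈ R⁺ for k = 0, 1, …, m}`. -/
def m {b : (IsKilling.rootSystem H).Base} (μ : PosRoot b) (i : b.support) : ℕ :=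
  sSup (stringSet μ i)

lemma isGreatest_m {b : (IsKilling.rootSystem H).Base} (μ : PosRoot b) (i : b.support) :
    IsGreatest (stringSet μ i) (m μ i) := by
  have hne : (stringSet μ i).Nonempty := ⟨0, fun k hk => ⟨μ, by simp [Nat.le_zero.mp hk]⟩⟩
  have hbdd : BddAbove (stringSet μ i) := by
    by_contra hcon
    have hall : ∀ k : ℕ, ∃ β : PosRoot b, β.wt = μ.wt - k • (simpleRoot b i).wt := by
      intro k
      rw [not_bddAbove_iff] at hcon
      obtain ⟨n, hn, hkn⟩ := hcon k
      exact hn k hkn.le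
    choose f hf using hall
    refine not_injective_infinite_finite f fun k l hkl => ?_
    have h := hf l
    rw [← hkl, hf k, sub_right_inj, ← Nat.cast_smul_eq_nsmul ℂ, ← Nat.cast_smul_eq_nsmul ℂ] at h
    exact_mod_cast smul_left_injective ℂ ((IsKilling.rootSystem H).ne_zero i.1) h
  exact ⟨Nat.sSup_mem hne hbdd, fun _ h => le_csSup hbdd h⟩

/-- The positive root `γ_i = μ - m_i α_i`. -/
def γ {b : (IsKilling.rootSystem H).Base} (μ : PosRoot b) (i : b.support) : PosRoot b :=
  ((isGreatest_m μ i).1 (m μ i) le_rfl).choose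

lemma γ_wt {b : (IsKilling.rootSystem H).Base} (μ : PosRoot b) (i : b.support) :
    (γ μ i).wt = μ.wt - m μ i • (simpleRoot b i).wt :=
  ((isGreatest_m μ i).1 (m μ i) le_rfl).choose_spec

variable {b : (IsKilling.rootSystem H).Base}

/-- The elementary cochain `e_β ⊗ f^α : x ↦ f^α(x) e_β`, where `f^α` are the elements of the basis
dual to `e`. -/
def elem (e : Basis (PosRoot b) ℂ (nilp b)) (β α : PosRoot b) :
    AdjointCohomology.C1 ℂ (nilp b) :=
  (e.coord α).smulRight (e β)

/-- The cochain `c_i = ∑_{α ∈ R⁺} A_i(α) e_α ⊗ f^α`. -/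
def c (e : Basis (PosRoot b) ℂ (nilp b)) (i : b.support) : AdjointCohomology.C1 ℂ (nilp b) :=
  ∑ α : PosRoot b, A b i α.wt • elem e α α

/-- The cochain `b_i = e_{γ_i} ⊗ f^{α_i}`. -/
def bb (e : Basis (PosRoot b) ℂ (nilp b)) (μ : PosRoot b) (i : b.support) :
    AdjointCohomology.C1 ℂ (nilp b) :=
  elem e (γ μ i) (simpleRoot b i)

/-- The 1-cochain `f` has weight `w`: it maps each root space `𝔤_α`, `α ∈ R⁺`, into
the root space `𝔤_{α + w}`. -/
def IsOfWeight (w : Dual ℂ H) (f : AdjointCohomology.C1 ℂ (nilp b)) : Prop :=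
  ∀ (α : PosRoot b) (x : nilp b), (x : 𝔤) ∈ rootSpace H α.wt →
    (f x : 𝔤) ∈ rootSpace H (α.wt + w : Dual ℂ H)

end MaxNilpotent

end

/-! A cocycle is a derivation `D` of 𝔫, so it is determined by its values on the simple root vectors
`e_i`; the task is to see which components `e_δ ⊗ f^{α_i}` survive modulo inner derivations. Take
negative root vectors `f_α` dual to the `e_α` for the Killing form and put `v = Σ [f_α, D e_α]` in
𝔤. The tensor `Σ f_α ⊗ e_α` is invariant under `ad e_i` up to the single term `[e_i, f_i] ⊗ e_i`, so
the derivation rule gives `[e_i, v] = Δ_i (D e_i)` with `Δ_i = Σ ad f_α ad e_α + ad [e_i, f_i]`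
(`lie_sum_eq_laplacian`).

Since `Δ_i = Σ_{α ≠ α_i} ad f_α ad e_α + ad e_i ad f_i`, 𝔰𝔩₂ theory makes it a nonnegative scalar on
each 𝔤_δ. The scalar is zero only if no positive `α ≠ α_i` can be added to `δ` and `δ - α_i` is not
a weight. Then `s_i δ` is a highest root, and uniqueness of the highest root gives `δ = s_i μ =
γ_i`. Hence a cocycle without components along `e_i ⊗ f^{α_i}` and `e_{γ_i} ⊗ f^{α_i}` is the
coboundary of a rescaling of the 𝔫-part of `v` (`exists_eq_lie`). Conversely, coboundaries have none
of these 2n components, and the `c_i`, `b_i` realise the standard basis of component vectors, so H¹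
has dimension 2n.

For the brackets, the `c_i` are diagonal, and the components of `[b_i, b_j]` vanish unless `γ_i =
α_j` and `γ_j = α_i`. In that case `μ = α_i + α_j`, full support of the highest root leaves only
three positive roots, and 𝔤 is 𝔰𝔩₃. The case of a simple `μ`, where `γ_i = s_i μ` fails, is likewise
𝔰𝔩₂. -/

noncomputable section

attribute [local instance 100] LieRing.ofAssociativeRing

/-! ### Highest roots of irreducible root systems -/

namespace RootPairing.Base

section Highest

variable {ι R M N : Type*} [CommRing R] [AddCommGroup M] [Module R M]
  [AddCommGroup N] [Module R N] {P : RootPairing ι R M N}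

lemma add_reflection_mem_range {i j k : ι}
    (h : P.reflection k (P.root i) + P.root j ∈ Set.range P.root) :
    P.root i + P.reflection k (P.root j) ∈ Set.range P.root := by
  obtain ⟨l, hl⟩ := h
  refine ⟨P.reflectionPerm k l, ?_⟩
  rw [root_reflectionPerm, hl, map_add, P.reflection_same]

variable [CharZero R] {b : P.Base}

/-- A positive root is highest if adding a positive root to it never gives a root. -/
def IsHighest (b : P.Base) (μ : ι) : Prop :=
  b.IsPos μ ∧ ∀ i, b.IsPos i → P.root μ + P.root i ∉ Set.range P.root

lemma IsPos.root_ne_neg {i j : ι} (hi : b.IsPos i) (hj : b.IsPos j) : P.root i ≠ -P.root j := by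
  let _ := P.indexNeg
  intro h
  have : i = -j := P.root.injective (by rw [h]; simp)
  exact (IsPos.neg_iff_not b j).mp (this ▸ hi) hj

lemma IsPos.root_add_ne_zero {i j : ι} (hi : b.IsPos i) (hj : b.IsPos j) :
    P.root i + P.root j ≠ 0 :=
  fun h => hi.root_ne_neg hj (eq_neg_of_add_eq_zero_left h)

lemma IsPos.exists_nat_coeff {i : ι} (hi : b.IsPos i) :
    ∃ f : ι → ℕ, P.root i = ∑ j ∈ b.support, f j • P.root j := by
  obtain ⟨f, -, h | h⟩ := b.exists_root_eq_sum_nat_or_neg i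
  · exact ⟨f, h⟩
  · have h' : P.root i = ∑ j ∈ b.support, (fun j => -(f j : ℤ)) j • P.root j := by
      simp [h]
    have := height_eq_sum h'
    rw [isPos_iff, this] at hi
    have : ∑ j ∈ b.support, -(f j : ℤ) ≤ 0 := Finset.sum_nonpos fun j _ => by simp
    lia

variable [P.IsCrystallographic]

lemma pairingIn_eq_sum {i : ι} {f : ι → ℕ} (hf : P.root i = ∑ j ∈ b.support, f j • P.root j)
    (k : ι) : P.pairingIn ℤ i k = ∑ j ∈ b.support, (f j : ℤ) * P.pairingIn ℤ j k :=
  FaithfulSMul.algebraMap_injective ℤ R <| by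
    simp_rw [algebraMap_pairingIn, map_sum, ← root_coroot_eq_pairing, hf, map_sum, map_nsmul,
      LinearMap.coe_sum, Finset.sum_apply, LinearMap.smul_apply, root_coroot_eq_pairing,
      nsmul_eq_mul, map_mul, algebraMap_pairingIn, map_natCast]

variable [IsDomain R] [Finite ι]

lemma IsHighest.pairingIn_nonneg {μ i : ι} (hμ : b.IsHighest μ) (hi : b.IsPos i) :
    0 ≤ P.pairingIn ℤ μ i := by
  by_contra! h
  exact hμ.2 i hi (P.root_add_root_mem_of_pairingIn_neg h (hμ.1.root_ne_neg hi))

variable [P.IsReduced]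

/-- A positive root different from the simple root `β` cannot be added to the reflection in `β`
of the highest root. -/
lemma IsHighest.reflectionPerm_add_notMem {μ β α : ι} (hμ : b.IsHighest μ) (hβ : β ∈ b.support)
    (hα : b.IsPos α) (hαβ : α ≠ β) :
    P.root (P.reflectionPerm β μ) + P.root α ∉ Set.range P.root := by
  intro h
  rw [root_reflectionPerm] at h
  have h' := add_reflection_mem_range h
  rw [← root_reflectionPerm] at h'
  exact hμ.2 _ (hα.reflectionPerm hβ hαβ) h'

/-- The `β`-string through the highest root `μ` consists of the `μ - k β` with
`k ≤ ⟨μ, β^∨⟩`. -/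
lemma IsHighest.sub_nsmul_mem_range_iff {μ β : ι} (hμ : b.IsHighest μ) (hβ : β ∈ b.support)
    (hne : μ ≠ β) (k : ℕ) :
    P.root μ - k • P.root β ∈ Set.range P.root ↔ (k : ℤ) ≤ P.pairingIn ℤ μ β := by
  have hli : LinearIndependent R ![P.root β, P.root μ] :=
    IsReduced.linearIndependent P hne.symm
      fun h => (isPos_of_mem_support hβ).root_ne_neg hμ.1 h
  have htop : P.chainTopCoeff β μ = 0 :=
    chainTopCoeff_eq_zero_iff.mpr (Or.inr (hμ.2 β (isPos_of_mem_support hβ)))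
  rw [root_sub_nsmul_mem_range_iff_le_chainBotCoeff hli,
    ← P.chainBotCoeff_sub_chainTopCoeff hli, htop]
  simp

variable [P.IsIrreducible]

/-- A simple root missing from the highest root but adjacent to one occurring in it would pair
negatively with it, against dominance. Connectedness of the Dynkin diagram spreads the nonvanishing
from one simple root to all. -/
lemma IsHighest.coeff_ne_zero {μ : ι} (hμ : b.IsHighest μ) {f : ι → ℕ}
    (hf : P.root μ = ∑ j ∈ b.support, f j • P.root j) (j : b.support) : f j ≠ 0 := by
  obtain ⟨i, hi, hfi⟩ : ∃ i ∈ b.support, f i ≠ 0 := by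
    by_contra! h
    refine P.ne_zero μ ?_
    rw [hf]
    exact Finset.sum_eq_zero fun i hi => by simp [h i hi]
  refine b.induction_on_cartanMatrix (p := fun j => f j ≠ 0) (i := ⟨i, hi⟩) hfi ?_
  intro i j hfi hij hfj
  have h0 := hμ.pairingIn_nonneg (isPos_of_mem_support j.2)
  rw [pairingIn_eq_sum hf] at h0
  refine h0.not_gt (Finset.sum_neg' (fun k hk => ?_) ⟨i, i.2, ?_⟩)
  · by_cases hkj : k = j
    · simp [hkj, hfj]
    · exact mul_nonpos_of_nonneg_of_nonpos (by positivity) (b.pairingIn_le_zero_of_ne hkj hk j.2)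
  · have hne : (i : ι) ≠ j := fun h => hfi (h ▸ hfj)
    refine mul_neg_of_pos_of_neg (by positivity)
      (lt_of_le_of_ne (b.pairingIn_le_zero_of_ne hne i.2 j.2) fun h => hij ?_)
    rw [cartanMatrix_apply_eq_zero_iff_symm]
    exact h

/-- Dominance of `ν` and full support of `μ` make the pairing of the two positive. If they differed,
`μ - ν` would be a root, and it or its negative could be added to one of them. -/
lemma IsHighest.eq {μ ν : ι} (hμ : b.IsHighest μ) (hν : b.IsHighest ν) : μ = ν := by
  obtain ⟨f, hf⟩ := hμ.1.exists_nat_coeff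
  have hpos : 0 < P.pairingIn ℤ μ ν := by
    obtain ⟨j, hj, hj'⟩ := hν.1.exists_mem_support_pos_pairingIn
    rw [pairingIn_eq_sum hf]
    refine Finset.sum_pos' (fun k hk => mul_nonneg (by positivity) ?_) ⟨j, hj, ?_⟩
    · have := hν.pairingIn_nonneg (isPos_of_mem_support hk)
      contrapose! this
      exact (P.pairingIn_lt_zero_iff ℤ).mp this
    · have := hμ.coeff_ne_zero hf ⟨j, hj⟩
      exact mul_pos (by positivity) hj'
  by_contra hne
  obtain ⟨k, hk⟩ := P.root_sub_root_mem_of_pairingIn_pos hpos hne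
  let _ := P.indexNeg
  rcases IsPos.or_neg b k with h | h
  · exact hν.2 k h ⟨μ, by rw [hk]; abel⟩
  · exact hμ.2 (-k) h ⟨ν, by
      rw [indexNeg_neg, root_reflectionPerm, reflection_apply_self, hk]; abel⟩

/-- A positive root to which no positive root other than the simple root `β` can be added, and from
which `β` cannot be subtracted, is the reflection in `β` of the highest root. -/
lemma IsHighest.eq_reflectionPerm {μ β δ : ι} (hμ : b.IsHighest μ) (hβ : β ∈ b.support)
    (hδ : b.IsPos δ) (hδβ : δ ≠ β)
    (hadd : ∀ α, b.IsPos α → α ≠ β → P.root δ + P.root α ∉ Set.range P.root)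
    (hsub : P.root δ - P.root β ∉ Set.range P.root) :
    δ = P.reflectionPerm β μ := by
  -- Adding `α` to `s_β δ` amounts to adding `s_β α` to `δ`. For `α ≠ β` this is a positive root
  -- other than `β`; for `α = β` it means subtracting `β` from `δ`.
  have key : b.IsHighest (P.reflectionPerm β δ) := by
    refine ⟨hδ.reflectionPerm hβ hδβ, fun α hα h => ?_⟩
    rw [root_reflectionPerm] at h
    have h' := add_reflection_mem_range h
    rcases eq_or_ne α β with rfl | hαβ
    · rw [reflection_apply_self, ← sub_eq_add_neg] at h'
      exact hsub h'
    · rw [← root_reflectionPerm] at h'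
      refine hadd _ (hα.reflectionPerm hβ hαβ) (fun h0 => ?_) h'
      refine hα.root_ne_neg (isPos_of_mem_support hβ) ?_
      rw [← P.reflection_apply_self, ← P.reflection_same β (P.root α), ← root_reflectionPerm, h0]
  rw [← key.eq hμ]
  simp

/-- If a simple root is highest then it is the only positive root. -/
lemma IsHighest.eq_of_mem_support {μ α : ι} (hμ : b.IsHighest μ) (hs : μ ∈ b.support)
    (hα : b.IsPos α) : α = μ := by
  have hsupp : ∀ j ∈ b.support, j = μ := by
    intro j hj
    classical
    have hf : P.root μ = ∑ j ∈ b.support, (if j = μ then 1 else 0 : ℕ) • P.root j := by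
      simp [ite_smul, hs]
    have := hμ.coeff_ne_zero (f := fun j => if j = μ then 1 else 0) hf ⟨j, hj⟩
    by_contra h
    simp [h] at this
  refine hα.induction_on_add (p := fun α => α = μ) hsupp ?_
  rintro i j k h rfl hj
  exact (hμ.2 j (isPos_of_mem_support hj) ⟨k, h⟩).elim

/-- If the highest root is the sum of two different simple roots then these three are the only
positive roots. -/
lemma IsHighest.eq_or_of_eq_add {μ i j α : ι} (hμ : b.IsHighest μ) (hi : i ∈ b.support)
    (hj : j ∈ b.support) (hij : i ≠ j) (h : P.root μ = P.root i + P.root j)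
    (hα : b.IsPos α) : α = i ∨ α = j ∨ α = μ := by
  have hsupp : ∀ k ∈ b.support, k = i ∨ k = j := by
    intro k hk
    classical
    have hf : P.root μ = ∑ l ∈ b.support, (if l = i ∨ l = j then 1 else 0 : ℕ) • P.root l := by
      have : ∀ l, (if l = i ∨ l = j then 1 else 0 : ℕ) =
          (if l = i then 1 else 0) + (if l = j then 1 else 0) := by
        intro l
        split_ifs <;> simp_all
      simp [this, add_smul, Finset.sum_add_distrib, ite_smul, hi, hj, h]
    have := hμ.coeff_ne_zero (f := fun l => if l = i ∨ l = j then 1 else 0) hf ⟨k, hk⟩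
    by_contra h
    simp [h] at this
  have : Module.IsReflexive R M := .of_isPerfPair P.toLinearMap
  have : IsAddTorsionFree M := .of_isTorsionFree R M
  have htwo : ∀ k l, P.root l ≠ P.root k + P.root k := fun k l h =>
    P.nsmul_notMem_range_root (n := 2) (i := k) ⟨l, by rw [h, two_smul]⟩
  refine hα.induction_on_add (p := fun α => α = i ∨ α = j ∨ α = μ)
    (fun k hk => (hsupp k hk).imp_right Or.inl) ?_
  intro l k m hm hl hk
  rcases hl with rfl | rfl | rfl
  · rcases hsupp k hk with rfl | rfl
    · exact (htwo _ _ hm).elim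
    · exact Or.inr (Or.inr (P.root.injective (by rw [hm, h])))
  · rcases hsupp k hk with rfl | rfl
    · exact Or.inr (Or.inr (P.root.injective (by rw [hm, h, add_comm])))
    · exact (htwo _ _ hm).elim
  · exact (hμ.2 k (isPos_of_mem_support hk) ⟨m, hm⟩).elim

end Highest

end RootPairing.Base

/-! ### Eigenvalues of `ad f ∘ ad e` on root spaces -/

namespace LieAlgebra.IsKilling

open LieModule

variable {K L : Type*} [Field K] [CharZero K] [LieRing L] [LieAlgebra K L]
  [IsKilling K L] [FiniteDimensional K L]
  {H : LieSubalgebra K L} [H.IsCartanSubalgebra] [IsTriangularizable K H L]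

lemma exists_smul_eq_of_mem_rootSpace {α : Weight K H L} (hα : α.IsNonZero) {x y : L}
    (hx : x ∈ rootSpace H α) (hx0 : x ≠ 0) (hy : y ∈ rootSpace H α) : ∃ k : K, y = k • x := by
  obtain ⟨k, hk⟩ := (finrank_eq_one_iff_of_nonzero' ⟨x, hx⟩ (by simpa using hx0)).mp
    (finrank_rootSpace_eq_one α hα) ⟨y, hy⟩
  exact ⟨k, by simpa using hk.symm⟩

/-- For an `sl₂`-triple attached to a root `α`, the composition `ad f ∘ ad e` acts on the root space
of `β` by a natural number, which vanishes only if `α + β` is not a weight. -/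
lemma exists_lie_f_lie_e_eq_natCast_smul {α β : Weight K H L} (hα : α.IsNonZero)
    (hβ : β.IsNonZero) {h e f : L} (t : IsSl2Triple h e f) (he : e ∈ rootSpace H α)
    (hf : f ∈ rootSpace H (-α)) :
    ∃ n : ℕ, (∀ z ∈ rootSpace H β, ⁅f, ⁅e, z⁆⁆ = (n : K) • z) ∧
      (n = 0 → rootSpace H (α + β) = ⊥) := by
  obtain rfl := t.h_eq_coroot hα he hf
  obtain ⟨v, hv, hv0⟩ := (chainTop α β).exists_ne_zero
  have prim : t.HasPrimitiveVectorWith v (chainLength α β : K) :=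
    have := lie_mem_genWeightSpace_of_mem_genWeightSpace he hv
    ⟨hv0, (chainLength_smul _ _ hv).symm, by rwa [genWeightSpace_add_chainTop _ _ hα] at this⟩
  set p := chainTopCoeff α β with hp
  have hpN : p ≤ chainLength α β := chainTopCoeff_le_chainLength α β
  -- The root space of `β` lies `p` steps below the top `v` of the `α`-string, so it is spanned by
  -- `f^p v`.
  have hmem : (toEnd K L L f ^ p) v ∈ rootSpace H β := by
    have := toEnd_pow_apply_mem hf hv p
    convert! this using 2
    rw [coe_chainTop', ← hp]
    simp
  have hne := prim.pow_toEnd_f_ne_zero_of_eq_nat rfl hpN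
  rcases Nat.eq_zero_or_pos p with h0 | hpos
  · refine ⟨0, fun z hz => ?_, fun _ => ?_⟩
    · obtain ⟨k, rfl⟩ := exists_smul_eq_of_mem_rootSpace hβ hmem hne hz
      simp [h0, prim.lie_e]
    · have := genWeightSpace_chainTopCoeff_add_one_nsmul_add α β hα
      rwa [← hp, h0, zero_add, one_smul] at this
  · obtain ⟨m, hm⟩ : ∃ m, p = m + 1 := ⟨p - 1, by lia⟩
    -- This is the 𝔰𝔩₂ formula `e f^(m+1) v = (m+1)(N-m) f^m v`, with `N` the length of the string
    -- and `p = m + 1 ≤ N`.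
    refine ⟨(m + 1) * (chainLength α β - m), fun z hz => ?_, fun h => ?_⟩
    · obtain ⟨k, rfl⟩ := exists_smul_eq_of_mem_rootSpace hβ hmem hne hz
      rw [hm, lie_smul, prim.lie_e_pow_succ_toEnd_f, lie_smul, lie_smul,
        prim.lie_f_pow_toEnd_f, smul_comm]
      congr 2
      push_cast [Nat.cast_sub (show m ≤ chainLength α β by lia)]
      ring
    · rcases Nat.mul_eq_zero.mp h with h | h <;> lia

/-- The Killing form takes a positive half-integral value on the nilpotent elements of an
`sl₂`-triple attached to a root. -/
lemma exists_killingForm_eq_of_isSl2Triple {α : Weight K H L} (hα : α.IsNonZero) {h e f : L}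
    (t : IsSl2Triple h e f) (he : e ∈ rootSpace H α) (hf : f ∈ rootSpace H (-α)) :
    ∃ n : ℕ, 0 < n ∧ 2 * killingForm K L e f = n := by
  -- By invariance κ(h, h) = κ([e, f], h) = κ(e, [f, h]) = 2 κ(e, f).
  have h1 : 2 * killingForm K L e f = killingForm K L h h := by
    have hfh : ⁅f, h⁆ = (2 : K) • f := by
      rw [← lie_skew, t.lie_lie_smul_f K, neg_neg]
    conv_rhs => rw [show killingForm K L h h = killingForm K L ⁅e, f⁆ h by rw [t.lie_e_f]]
    rw [LieModule.traceForm_apply_lie_apply, hfh, map_smul, smul_eq_mul]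
  rw [h1, t.h_eq_coroot hα he hf]
  have h2 : killingForm K L (coroot α : L) (coroot α : L)
      = ∑ χ ∈ H.root, χ (coroot α) * χ (coroot α) := by
    have := congrArg (fun B => B (coroot α) (coroot α)) (restrict_killingForm_eq_sum (H := H))
    simp only [LinearMap.BilinForm.restrict_apply, LinearMap.domRestrict_apply, LinearMap.coe_sum, Finset.sum_apply, LinearMap.smulRight_apply, LinearMap.smul_apply, smul_eq_mul] at this
    exact this
  rw [h2]
  -- κ(h, h) is the sum of the squares of the integers `χ(α^∨)`, and `χ = α` alone contributes 4.
  refine ⟨∑ χ ∈ H.root, (chainBotCoeff α χ - chainTopCoeff α χ : ℤ).natAbs ^ 2, ?_, ?_⟩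
  · refine Finset.sum_pos' (fun _ _ => by positivity) ⟨α, by simpa using hα, ?_⟩
    have h3 := apply_coroot_eq_cast α α
    rw [root_apply_coroot hα] at h3
    have : (chainBotCoeff α α - chainTopCoeff α α : ℤ) = 2 := by exact_mod_cast h3.symm
    rw [this]; norm_num
  · rw [Nat.cast_sum]
    refine Finset.sum_congr rfl fun χ _ => ?_
    rw [apply_coroot_eq_cast α χ, ← sq, ← Int.cast_pow, ← Int.natAbs_sq, Int.cast_pow,
      Int.cast_natCast, Nat.cast_pow]

/-- If `f` is the element of the root space of `-α` dual to the root vector `e` then `ad f ∘ ad e`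
acts on the root space of `β` by a nonnegative rational number, which vanishes only if `α + β` is
not a weight. -/
lemma exists_lie_lie_eq_smul_of_killingForm_eq_one {α β : Weight K H L} (hα : α.IsNonZero)
    (hβ : β.IsNonZero) {e f : L} (he : e ∈ rootSpace H α) (hf : f ∈ rootSpace H (-α))
    (hef : killingForm K L e f = 1) :
    ∃ q : ℚ, 0 ≤ q ∧ (∀ z ∈ rootSpace H β, ⁅f, ⁅e, z⁆⁆ = (q : K) • z) ∧
      (q = 0 → rootSpace H (α + β) = ⊥) := by
  obtain ⟨h', e', f', t, he', hf'⟩ := exists_isSl2Triple_of_weight_isNonZero hα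
  obtain ⟨N, hN, hN'⟩ := exists_killingForm_eq_of_isSl2Triple hα t he' hf'
  obtain ⟨n, hn, hn'⟩ := exists_lie_f_lie_e_eq_natCast_smul hα hβ t he' hf'
  obtain ⟨k, rfl⟩ := exists_smul_eq_of_mem_rootSpace hα he' t.e_ne_zero he
  obtain ⟨l, rfl⟩ := exists_smul_eq_of_mem_rootSpace (α := -α) hα.neg (by simpa using hf')
    t.f_ne_zero (by simpa using hf)
  have hkl : k * l * N = 2 := by
    rw [← hN']
    simp only [map_smul, LinearMap.smul_apply, smul_eq_mul] at hef
    linear_combination 2 * hef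
  -- With `e = k e'` and `f = l f'` for the triple's `e'`, `f'`, the normalisation κ(e, f) = 1 reads
  -- `k l N = 2`.
  refine ⟨2 * n / N, by positivity, fun z hz => ?_, fun h => hn' ?_⟩
  · have hN0 : (N : K) ≠ 0 := by exact_mod_cast hN.ne'
    simp only [smul_lie, lie_smul, hn z hz, smul_smul]
    congr 1
    push_cast
    rw [eq_div_iff hN0]
    linear_combination (n : K) * hkl
  · have hN0 : (N : ℚ) ≠ 0 := by exact_mod_cast hN.ne'
    rw [div_eq_zero_iff] at h
    have := h.resolve_right hN0
    simpa using this

lemma lie_ne_zero_of_mem_rootSpace {α β : Weight K H L} (hα : α.IsNonZero) (hβ : β.IsNonZero)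
    (hαβ : rootSpace H (α + β) ≠ ⊥) {x y : L} (hx : x ∈ rootSpace H α) (hx0 : x ≠ 0)
    (hy : y ∈ rootSpace H β) (hy0 : y ≠ 0) : ⁅x, y⁆ ≠ 0 := by
  obtain ⟨h, e, f, t, he, hf⟩ := exists_isSl2Triple_of_weight_isNonZero hα
  obtain ⟨n, hn, hn'⟩ := exists_lie_f_lie_e_eq_natCast_smul hα hβ t he hf
  obtain ⟨k, rfl⟩ := exists_smul_eq_of_mem_rootSpace hα hx hx0 he
  intro hxy
  have := hn y hy
  rw [smul_lie, hxy, smul_zero, lie_zero, eq_comm, smul_eq_zero] at this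
  rcases this with h | h
  · exact hαβ (hn' (by exact_mod_cast h))
  · exact hy0 h

end LieAlgebra.IsKilling

/-! ### Killing-dual root vectors and the Laplacian identity -/

namespace MaxNilpotent

variable {𝔤 : Type*} [LieRing 𝔤] [LieAlgebra ℂ 𝔤] [FiniteDimensional ℂ 𝔤] [IsSimple ℂ 𝔤]
  {H : LieSubalgebra ℂ 𝔤} [H.IsCartanSubalgebra] {b : (IsKilling.rootSystem H).Base}

lemma PosRoot.wt_injective : Function.Injective (PosRoot.wt (b := b)) := fun _ _ h =>
  Subtype.ext ((IsKilling.rootSystem H).root.injective h)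

lemma PosRoot.wt_add_ne_zero (α β : PosRoot b) : α.wt + β.wt ≠ 0 :=
  α.2.root_add_ne_zero β.2

lemma PosRoot.wt_ne_zero (α : PosRoot b) : α.wt ≠ 0 := (IsKilling.rootSystem H).ne_zero α.1

lemma PosRoot.isNonZero (α : PosRoot b) : α.1.1.IsNonZero := H.isNonZero_coe_root α.1

/-- The root space of a nonzero linear form is nonzero precisely if the form is a root. -/
lemma rootSpace_ne_bot_iff {χ : Dual ℂ H} (hχ : χ ≠ 0) :
    rootSpace H χ ≠ ⊥ ↔ χ ∈ Set.range (IsKilling.rootSystem H).root := by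
  constructor
  · intro h
    let γ : LieModule.Weight ℂ H 𝔤 := ⟨χ, h⟩
    have hγ : γ ∈ H.root := by
      rw [LieSubalgebra.root, Finset.mem_filter]
      refine ⟨Finset.mem_univ _, fun hz => hχ ?_⟩
      ext z
      exact congrFun hz z
    exact ⟨⟨γ, hγ⟩, by ext z; rfl⟩
  · rintro ⟨γ, rfl⟩
    exact γ.1.genWeightSpace_ne_bot

lemma exists_posRoot_of_rootSpace_ne_bot {χ : Dual ℂ H} (hχ : χ ≠ 0) (h : rootSpace H χ ≠ ⊥) :
    ∃ γ : PosRoot b, χ = γ.wt ∨ χ = -γ.wt := by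
  obtain ⟨k, rfl⟩ := (rootSpace_ne_bot_iff hχ).mp h
  let _ := (IsKilling.rootSystem H).indexNeg
  rcases RootPairing.Base.IsPos.or_neg b k with h | h
  · exact ⟨⟨k, h⟩, Or.inl rfl⟩
  · refine ⟨⟨-k, h⟩, Or.inr ?_⟩
    change _ = -(IsKilling.rootSystem H).root (-k)
    rw [RootPairing.indexNeg_neg, RootPairing.root_reflectionPerm,
      RootPairing.reflection_apply_self, neg_neg]

/-- A simple root is not the sum of two positive roots. -/
lemma simpleRoot_wt_ne_add (i : b.support) (α γ : PosRoot b) :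
    (simpleRoot b i).wt ≠ α.wt + γ.wt := by
  intro h
  have h1 := b.height_add h
  have h2 := RootPairing.Base.height_one_of_mem_support i.2
  have h3 := α.2
  have h4 := γ.2
  rw [RootPairing.Base.isPos_iff] at h3 h4
  change b.height i.1 = _ at h1
  lia

/-- A basis of `𝔫` consisting of root vectors, together with the family of root vectors for the
negative roots that is dual to it with respect to the Killing form. -/
structure IsDualRootBasis (e : Basis (PosRoot b) ℂ (nilp b)) (f : PosRoot b → 𝔤) : Prop where
  mem (α : PosRoot b) : (e α : 𝔤) ∈ rootSpace H α.wt
  mem_neg (α : PosRoot b) : f α ∈ rootSpace H (-α.wt : Dual ℂ H)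
  killingForm_eq_one (α : PosRoot b) : killingForm ℂ 𝔤 (e α) (f α) = 1

variable {e : Basis (PosRoot b) ℂ (nilp b)} {f : PosRoot b → 𝔤}

lemma basis_coe_ne_zero (e : Basis (PosRoot b) ℂ (nilp b)) (α : PosRoot b) : (e α : 𝔤) ≠ 0 :=
  fun h => e.ne_zero α (Subtype.ext h)

/-- The Killing form is nondegenerate and pairs the root space of `α` only with that of `-α`. -/
lemma exists_isDualRootBasis (he : ∀ α, (e α : 𝔤) ∈ rootSpace H α.wt) :
    ∃ f : PosRoot b → 𝔤, IsDualRootBasis e f := by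
  have key : ∀ α : PosRoot b, ∃ y ∈ rootSpace H (-α.wt : Dual ℂ H),
      killingForm ℂ 𝔤 (e α) y = 1 := by
    intro α
    obtain ⟨y, hy, hy0⟩ : ∃ y ∈ rootSpace H (-α.wt : Dual ℂ H),
        killingForm ℂ 𝔤 (e α) y ≠ 0 := by
      by_contra! h
      refine basis_coe_ne_zero e α ?_
      simpa using mem_ker_killingForm_of_mem_rootSpace_of_forall_rootSpace_neg ℂ 𝔤 H (he α) h
    exact ⟨(killingForm ℂ 𝔤 (e α) y)⁻¹ • y, Submodule.smul_mem _ _ hy, by simp [hy0]⟩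
  choose f hf hf' using key
  exact ⟨f, he, hf, hf'⟩

namespace IsDualRootBasis

lemma killingForm_apply [DecidableEq (PosRoot b)] (h : IsDualRootBasis e f) (α β : PosRoot b) :
    killingForm ℂ 𝔤 (e α) (f β) = if α = β then 1 else 0 := by
  split_ifs with hαβ
  · rw [hαβ, h.killingForm_eq_one]
  · refine killingForm_apply_eq_zero_of_mem_rootSpace_of_add_ne_zero ℂ 𝔤 H (h.mem α)
      (h.mem_neg β) fun h0 => hαβ (PosRoot.wt_injective ?_)
    ext z
    have := congrFun h0 z
    simpa [← sub_eq_add_neg, sub_eq_zero] using this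

lemma killingForm_apply' [DecidableEq (PosRoot b)] (h : IsDualRootBasis e f) (α β : PosRoot b) :
    killingForm ℂ 𝔤 (f α) (e β) = if α = β then 1 else 0 := by
  rw [LieModule.traceForm_comm, h.killingForm_apply]
  simp [eq_comm]

lemma coord_eq (h : IsDualRootBasis e f) (α : PosRoot b) (x : nilp b) :
    e.coord α x = killingForm ℂ 𝔤 (f α) x := by
  classical
  conv_rhs => rw [← e.sum_repr x]
  simp only [AddSubmonoidClass.coe_finsetSum, map_sum, SetLike.val_smul, map_smul,
    h.killingForm_apply', smul_eq_mul]
  simp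

lemma coe_eq_sum (h : IsDualRootBasis e f) (x : nilp b) :
    x = ∑ α, killingForm ℂ 𝔤 (f α) x • e α := by
  conv_lhs => rw [← e.sum_repr x]
  simp [← h.coord_eq]

lemma f_ne_zero (h : IsDualRootBasis e f) (α : PosRoot b) : f α ≠ 0 := fun h0 => by
  simpa [h0] using h.killingForm_eq_one α

lemma eq_smul_neg (h : IsDualRootBasis e f) {α : PosRoot b} {x : 𝔤}
    (hx : x ∈ rootSpace H (-α.wt : Dual ℂ H)) : x = killingForm ℂ 𝔤 (e α) x • f α := by
  classical
  obtain ⟨k, rfl⟩ := IsKilling.exists_smul_eq_of_mem_rootSpace (α := -α.1.1) α.isNonZero.neg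
    (h.mem_neg α) (h.f_ne_zero α) hx
  simp [h.killingForm_apply]

lemma eq_sum_neg (h : IsDualRootBasis e f) {α : PosRoot b} {x : 𝔤}
    (hx : x ∈ rootSpace H (-α.wt : Dual ℂ H)) : x = ∑ γ, killingForm ℂ 𝔤 (e γ) x • f γ := by
  classical
  rw [h.eq_smul_neg hx]
  simp [h.killingForm_apply, ite_smul]

/-- The bracket of a simple root vector and the dual of another root vector. -/
lemma lie_simple_f (h : IsDualRootBasis e f) (i : b.support) {α : PosRoot b}
    (hα : α ≠ simpleRoot b i) :
    ⁅(e (simpleRoot b i) : 𝔤), f α⁆ =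
      -∑ γ, killingForm ℂ 𝔤 (f α) ⁅(e (simpleRoot b i) : 𝔤), (e γ : 𝔤)⁆ • f γ := by
  have hmem : _ ∈ rootSpace H ((simpleRoot b i).wt + -α.wt : Dual ℂ H) := lie_mem_genWeightSpace_of_mem_genWeightSpace (h.mem (simpleRoot b i)) (h.mem_neg α)
  -- The weight `α_i - α` is nonzero and not a positive root, since a simple root is not a sum of
  -- two positive ones. The bracket thus lies among the negative root spaces and is expanded by
  -- pairing with the `e_γ`.
  have key : ⁅(e (simpleRoot b i) : 𝔤), f α⁆ =
      ∑ γ, killingForm ℂ 𝔤 (e γ) ⁅(e (simpleRoot b i) : 𝔤), f α⁆ • f γ := by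
    by_cases hbot : rootSpace H ((simpleRoot b i).wt + -α.wt : Dual ℂ H) = ⊥
    · rw [hbot, LieSubmodule.mem_bot] at hmem
      simp [hmem]
    · have hne : (simpleRoot b i).wt + -α.wt ≠ 0 := fun h0 => hα (PosRoot.wt_injective
        (by rw [← sub_eq_add_neg, sub_eq_zero] at h0; exact h0.symm))
      obtain ⟨γ, hγ | hγ⟩ := exists_posRoot_of_rootSpace_ne_bot (b := b) hne hbot
      · exact (simpleRoot_wt_ne_add i α γ (by rw [← hγ]; abel)).elim
      · rw [hγ] at hmem
        exact h.eq_sum_neg hmem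
  rw [key, ← Finset.sum_neg_distrib]
  refine Finset.sum_congr rfl fun γ _ => ?_
  rw [← neg_smul]
  congr 1
  rw [← LieModule.traceForm_apply_lie_apply, LieModule.traceForm_comm, ← lie_skew, map_neg]

/-- The bracket has weight `α_i + γ ≠ α_i`. This lets the sum in `lie_simple_f` also be written when
`α = α_i`, where it contributes nothing. -/
lemma killingForm_f_lie (h : IsDualRootBasis e f) (i : b.support) (γ : PosRoot b) :
    killingForm ℂ 𝔤 (f (simpleRoot b i)) ⁅(e (simpleRoot b i) : 𝔤), (e γ : 𝔤)⁆ = 0 := by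
  have hmem : _ ∈ rootSpace H ((simpleRoot b i).wt + γ.wt : Dual ℂ H) :=
    lie_mem_genWeightSpace_of_mem_genWeightSpace (h.mem (simpleRoot b i)) (h.mem γ)
  refine killingForm_apply_eq_zero_of_mem_rootSpace_of_add_ne_zero ℂ 𝔤 H (h.mem_neg _) hmem
    fun h0 => γ.wt_ne_zero ?_
  ext z
  simpa using congrFun h0 z

end IsDualRootBasis

/-- The operator `∑ ad f_α ∘ ad e_α + ad [e_i, f_i]`, where the sum is over the positive roots. -/
def laplacian (e : Basis (PosRoot b) ℂ (nilp b)) (f : PosRoot b → 𝔤) (i : b.support) :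
    𝔤 →ₗ[ℂ] 𝔤 :=
  ∑ α, ad ℂ 𝔤 (f α) ∘ₗ ad ℂ 𝔤 (e α) + ad ℂ 𝔤 ⁅(e (simpleRoot b i) : 𝔤), f (simpleRoot b i)⁆

lemma laplacian_apply (e : Basis (PosRoot b) ℂ (nilp b)) (f : PosRoot b → 𝔤) (i : b.support)
    (z : 𝔤) : laplacian e f i z = ∑ α, ⁅f α, ⁅(e α : 𝔤), z⁆⁆ +
      ⁅⁅(e (simpleRoot b i) : 𝔤), f (simpleRoot b i)⁆, z⁆ := by
  simp [laplacian]

namespace IsDualRootBasis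

/-- For a cocycle `D`, the element `∑ [f_α, D e_α]` of `𝔤` has the coboundary
`e_i ↦ laplacian (D e_i)` on simple root vectors. -/
lemma lie_sum_eq_laplacian (h : IsDualRootBasis e f) (D : AdjointCohomology.C1 ℂ (nilp b))
    (hD : ∀ x y, D ⁅x, y⁆ = ⁅x, D y⁆ - ⁅y, D x⁆) (i : b.support) :
    ⁅(e (simpleRoot b i) : 𝔤), ∑ α, ⁅f α, (D (e α) : 𝔤)⁆⁆ =
      laplacian e f i (D (e (simpleRoot b i))) := by
  classical
  set β := simpleRoot b i with hβ
  have h1 : ∀ α, ⁅(e β : 𝔤), ⁅f α, (D (e α) : 𝔤)⁆⁆ = ⁅⁅(e β : 𝔤), f α⁆, (D (e α) : 𝔤)⁆ +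
      ⁅f α, (D ⁅e β, e α⁆ : 𝔤)⁆ + ⁅f α, ⁅(e α : 𝔤), (D (e β) : 𝔤)⁆⁆ := by
    intro α
    rw [leibniz_lie, hD]
    simp only [AddSubgroupClass.coe_sub, LieSubalgebra.coe_bracket, lie_sub]
    abel
  have h2 : ∀ α, ⁅f α, (D ⁅e β, e α⁆ : 𝔤)⁆ =
      ∑ γ, killingForm ℂ 𝔤 (f γ) ⁅(e β : 𝔤), (e α : 𝔤)⁆ • ⁅f α, (D (e γ) : 𝔤)⁆ := by
    intro α
    rw [h.coe_eq_sum ⁅e β, e α⁆]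
    simp [LieSubalgebra.coe_bracket, map_sum, lie_sum, AddSubmonoidClass.coe_finsetSum]
  have h3 : ∀ α, ⁅(e β : 𝔤), f α⁆ = (if α = β then ⁅(e β : 𝔤), f β⁆ else 0) -
      ∑ γ, killingForm ℂ 𝔤 (f α) ⁅(e β : 𝔤), (e γ : 𝔤)⁆ • f γ := by
    intro α
    split_ifs with hα
    · rw [hα, Finset.sum_eq_zero, sub_zero]
      intro γ _
      rw [hβ, h.killingForm_f_lie, zero_smul]
    · rw [h.lie_simple_f i hα, zero_sub]
  -- Invariance of `Σ f_α ⊗ e_α` under `ad e_β` up to `[e_β, f_β] ⊗ e_β`: after expansion and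
  -- exchange of the summation indices, the structure constants cancel.
  have h4 : ∑ α, ⁅⁅(e β : 𝔤), f α⁆, (D (e α) : 𝔤)⁆ = ⁅⁅(e β : 𝔤), f β⁆, (D (e β) : 𝔤)⁆ -
      ∑ α, ⁅f α, (D ⁅e β, e α⁆ : 𝔤)⁆ := by
    simp_rw [h2]
    rw [Finset.sum_comm]
    have : ∀ α, ⁅⁅(e β : 𝔤), f α⁆, (D (e α) : 𝔤)⁆ =
        (if α = β then ⁅⁅(e β : 𝔤), f β⁆, (D (e β) : 𝔤)⁆ else 0) -
        ∑ γ, killingForm ℂ 𝔤 (f α) ⁅(e β : 𝔤), (e γ : 𝔤)⁆ • ⁅f γ, (D (e α) : 𝔤)⁆ := by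
      intro α
      rw [h3, sub_lie, sum_lie]
      simp_rw [smul_lie]
      congr 1
      split_ifs with hα
      · rw [hα]
      · simp
    rw [Finset.sum_congr rfl fun α _ => this α, Finset.sum_sub_distrib,
      Finset.sum_ite_eq' Finset.univ β, if_pos (Finset.mem_univ β)]
  rw [lie_sum, laplacian_apply]
  simp_rw [h1]
  rw [Finset.sum_add_distrib, Finset.sum_add_distrib, h4]
  abel

end IsDualRootBasis

end MaxNilpotent

/-! ### Spectrum of the Laplacian and the criterion for coboundaries -/

namespace MaxNilpotent

variable {𝔤 : Type*} [LieRing 𝔤] [LieAlgebra ℂ 𝔤] [FiniteDimensional ℂ 𝔤] [IsSimple ℂ 𝔤]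
  {H : LieSubalgebra ℂ 𝔤} [H.IsCartanSubalgebra] {b : (IsKilling.rootSystem H).Base}
  {e : Basis (PosRoot b) ℂ (nilp b)} {f : PosRoot b → 𝔤}

lemma rootSpace_add_eq_bot_iff (α β : PosRoot b) :
    rootSpace H (α.wt + β.wt : Dual ℂ H) = ⊥ ↔
      α.wt + β.wt ∉ Set.range (IsKilling.rootSystem H).root := by
  rw [← rootSpace_ne_bot_iff (α.wt_add_ne_zero β), not_not]

lemma rootSpace_sub_eq_bot_iff {α β : PosRoot b} (h : α ≠ β) :
    rootSpace H (α.wt - β.wt : Dual ℂ H) = ⊥ ↔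
      α.wt - β.wt ∉ Set.range (IsKilling.rootSystem H).root := by
  rw [← rootSpace_ne_bot_iff (sub_ne_zero.mpr fun h' => h (PosRoot.wt_injective h')), not_not]

lemma PosRoot.rootSpace_ne_bot (α : PosRoot b) : rootSpace H α.wt ≠ ⊥ :=
  α.1.1.genWeightSpace_ne_bot

namespace IsDualRootBasis

/-- A sum of nonnegative numbers is zero only if every summand is, so the eigenvalue can vanish only
where no positive root can be added. -/
lemma exists_sum_lie_lie_eq_smul (h : IsDualRootBasis e f) (w : PosRoot b) :
    ∃ q : ℚ, (∀ z ∈ rootSpace H w.wt, ∑ α, ⁅f α, ⁅(e α : 𝔤), z⁆⁆ = (q : ℂ) • z) ∧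
      (q = 0 → ∀ α : PosRoot b, rootSpace H (α.wt + w.wt : Dual ℂ H) = ⊥) := by
  have key := fun α : PosRoot b => IsKilling.exists_lie_lie_eq_smul_of_killingForm_eq_one
    α.isNonZero w.isNonZero (h.mem α) (h.mem_neg α) (h.killingForm_eq_one α)
  choose q hq hq' hq'' using key
  refine ⟨∑ α, q α, fun z hz => ?_, fun h0 α => ?_⟩
  · simp_rw [fun α => hq' α z hz]
    rw [← Finset.sum_smul, Rat.cast_sum]
  · exact hq'' α ((Finset.sum_eq_zero_iff_of_nonneg fun α _ => hq α).mp h0 α (Finset.mem_univ α))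

/-- The operator `laplacian` acts on positive root spaces by nonnegative rational numbers. -/
lemma exists_laplacian_eq_smul (h : IsDualRootBasis e f) (i : b.support) (δ : PosRoot b) :
    ∃ q : ℚ, (∀ z ∈ rootSpace H δ.wt, laplacian e f i z = (q : ℂ) • z) ∧
      (q = 0 → (∀ α : PosRoot b, α ≠ simpleRoot b i →
        rootSpace H (α.wt + δ.wt : Dual ℂ H) = ⊥) ∧
        rootSpace H (δ.wt - (simpleRoot b i).wt : Dual ℂ H) = ⊥) := by
  classical
  have key := fun α : PosRoot b => IsKilling.exists_lie_lie_eq_smul_of_killingForm_eq_one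
    α.isNonZero δ.isNonZero (h.mem α) (h.mem_neg α) (h.killingForm_eq_one α)
  choose q hq hq' hq'' using key
  -- Roles exchanged: `-α_i` is the root and `f_i` its root vector, so `r` is the eigenvalue of `ad
  -- e_i ∘ ad f_i`. By the Jacobi identity the extra term of the Laplacian turns the `α_i` summand
  -- into this operator.
  obtain ⟨r, hr, hr', hr''⟩ := IsKilling.exists_lie_lie_eq_smul_of_killingForm_eq_one
    (α := -(simpleRoot b i).1.1) (simpleRoot b i).isNonZero.neg δ.isNonZero
    (h.mem_neg (simpleRoot b i)) (f := (e (simpleRoot b i) : 𝔤))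
    (by rw [LieModule.Weight.coe_neg, neg_neg]; exact h.mem (simpleRoot b i))
    (by rw [LieModule.traceForm_comm]; exact h.killingForm_eq_one _)
  refine ⟨∑ α ∈ Finset.univ.erase (simpleRoot b i), q α + r, fun z hz => ?_, fun h0 => ?_⟩
  · rw [laplacian_apply, lie_lie, ← Finset.add_sum_erase _ _ (Finset.mem_univ (simpleRoot b i)),
      Finset.sum_congr rfl fun α _ => hq' α z hz, hr' z hz, ← Finset.sum_smul]
    push_cast
    rw [add_smul]
    abel
  · have hs := Finset.sum_nonneg fun α (_ : α ∈ Finset.univ.erase (simpleRoot b i)) => hq α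
    have h1 : ∑ α ∈ Finset.univ.erase (simpleRoot b i), q α = 0 := by linarith
    have h2 : r = 0 := by linarith
    refine ⟨fun α hα => hq'' α ((Finset.sum_eq_zero_iff_of_nonneg fun α _ => hq α).mp h1 α
      (by simp [hα])), ?_⟩
    have := hr'' h2
    rw [sub_eq_neg_add]
    exact this

/-- The eigenvalue of `laplacian` for the simple root `α_i` on the root space of `α_i + w` depends
only on `w`. -/
lemma laplacian_eigenvalue_eq (h : IsDualRootBasis e f) {i : b.support} {δ w : PosRoot b}
    (hδ : δ.wt = (simpleRoot b i).wt + w.wt) {q r : ℚ}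
    (hq : ∀ z ∈ rootSpace H w.wt, ∑ α, ⁅f α, ⁅(e α : 𝔤), z⁆⁆ = (q : ℂ) • z)
    (hr : ∀ z ∈ rootSpace H δ.wt, laplacian e f i z = (r : ℂ) • z) : q = r := by
  have hmem : ⁅(e (simpleRoot b i) : 𝔤), (e w : 𝔤)⁆ ∈ rootSpace H δ.wt := by
    rw [hδ]
    exact lie_mem_genWeightSpace_of_mem_genWeightSpace (h.mem _) (h.mem _)
  have hne : ⁅(e (simpleRoot b i) : 𝔤), (e w : 𝔤)⁆ ≠ 0 := by
    refine IsKilling.lie_ne_zero_of_mem_rootSpace (simpleRoot b i).isNonZero w.isNonZero ?_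
      (h.mem _) (basis_coe_ne_zero e _) (h.mem _) (basis_coe_ne_zero e _)
    have := δ.rootSpace_ne_bot
    rw [hδ] at this
    exact this
  -- The identity is tested on the coboundary of `e_w`, for which `v = q e_w` and `D e_i = [e_i,
  -- e_w]` is a nonzero vector of 𝔤_δ.
  have key := h.lie_sum_eq_laplacian (AdjointCohomology.d₀₁ ℂ (nilp b) (e w)) (fun x y => by
    change ⁅⁅x, y⁆, e w⁆ = ⁅x, ⁅y, e w⁆⁆ - ⁅y, ⁅x, e w⁆⁆
    rw [lie_lie]) i
  change ⁅(e (simpleRoot b i) : 𝔤), ∑ α, ⁅f α, ⁅(e α : 𝔤), (e w : 𝔤)⁆⁆⁆ =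
    laplacian e f i ⁅(e (simpleRoot b i) : 𝔤), (e w : 𝔤)⁆ at key
  rw [hq _ (h.mem w), hr _ hmem, lie_smul] at key
  exact_mod_cast smul_left_injective ℂ hne key

lemma killingForm_laplacian (h : IsDualRootBasis e f) {i : b.support} {δ : PosRoot b} {q : ℚ}
    (hq : ∀ z ∈ rootSpace H δ.wt, laplacian e f i z = (q : ℂ) • z) (z : nilp b) :
    killingForm ℂ 𝔤 (f δ) (laplacian e f i z) = q * killingForm ℂ 𝔤 (f δ) z := by
  classical
  have key : ∀ α : PosRoot b, killingForm ℂ 𝔤 (f δ) (laplacian e f i (e α)) =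
      q * killingForm ℂ 𝔤 (f δ) (e α) := by
    intro α
    obtain ⟨r, hr, -⟩ := h.exists_laplacian_eq_smul i α
    rw [hr _ (h.mem α), map_smul, smul_eq_mul]
    by_cases hδ : δ = α
    · subst hδ
      have := (hr _ (h.mem δ)).symm.trans (hq _ (h.mem δ))
      rw [smul_left_injective ℂ (basis_coe_ne_zero e δ) this]
    · simp [h.killingForm_apply', hδ]
  have hz : (z : 𝔤) = ∑ α, killingForm ℂ 𝔤 (f α) z • (e α : 𝔤) := by
    conv_lhs => rw [h.coe_eq_sum z]
    simp [AddSubmonoidClass.coe_finsetSum]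
  rw [hz]
  simp only [map_sum, map_smul, smul_eq_mul, key, Finset.mul_sum]
  exact Finset.sum_congr rfl fun α _ => by ring

/-- A derivation of `𝔫` which vanishes on the simple root vectors is zero. -/
lemma eq_zero_of_simpleRoot (h : IsDualRootBasis e f) (D : AdjointCohomology.C1 ℂ (nilp b))
    (hD : ∀ x y, D ⁅x, y⁆ = ⁅x, D y⁆ - ⁅y, D x⁆) (h0 : ∀ i, D (e (simpleRoot b i)) = 0) :
    D = 0 := by
  refine e.ext fun α => ?_
  obtain ⟨k, hk⟩ := α
  rw [LinearMap.zero_apply]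
  revert hk
  suffices ∀ k, b.IsPos k → ∀ hk : b.IsPos k, D (e ⟨k, hk⟩) = 0 from fun hk => this k hk hk
  intro k hk
  refine hk.induction_on_add (p := fun k => ∀ hk : b.IsPos k, D (e ⟨k, hk⟩) = 0)
    (fun i hi _ => h0 ⟨i, hi⟩) ?_
  intro i j k hijk hi hj hk
  have hi' : b.IsPos i := hk.sub hj (by rw [hijk]; abel)
  set α : PosRoot b := ⟨i, hi'⟩
  set β : PosRoot b := simpleRoot b ⟨j, hj⟩ with hβ
  set γ : PosRoot b := ⟨k, hk⟩
  have hγ : γ.wt = β.wt + α.wt := by rw [add_comm]; exact hijk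
  have hmem : ⁅(e β : 𝔤), (e α : 𝔤)⁆ ∈ rootSpace H γ.wt := by
    rw [hγ]
    exact lie_mem_genWeightSpace_of_mem_genWeightSpace (h.mem _) (h.mem _)
  have hne : ⁅(e β : 𝔤), (e α : 𝔤)⁆ ≠ 0 := by
    refine IsKilling.lie_ne_zero_of_mem_rootSpace β.isNonZero α.isNonZero ?_
      (h.mem _) (basis_coe_ne_zero e _) (h.mem _) (basis_coe_ne_zero e _)
    have := γ.rootSpace_ne_bot
    rw [hγ] at this
    exact this
  -- Root spaces being lines, `e_γ` is a multiple of `[e_β, e_α]`: the simple root vectors generate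
  -- 𝔫.
  obtain ⟨c, hc⟩ := IsKilling.exists_smul_eq_of_mem_rootSpace γ.isNonZero hmem hne (h.mem γ)
  have hc' : e γ = c • ⁅e β, e α⁆ := Subtype.ext hc
  rw [hc', map_smul, hD, hi hi', h0]
  simp

end IsDualRootBasis

/-- A positive root is a sum of simple roots, so a root `μ + α` would exceed `μ` in the order. -/
lemma IsMaximalRoot.isHighest {μ : PosRoot b} (hμ : IsMaximalRoot b μ) : b.IsHighest μ.1 := by
  refine ⟨μ.2, fun i hi ⟨k, hk⟩ => ?_⟩
  have hkpos : b.IsPos k := μ.2.add hi hk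
  have hk' : PosRoot.wt (b := b) ⟨k, hkpos⟩ - μ.wt = PosRoot.wt (b := b) ⟨i, hi⟩ := by
    rw [sub_eq_iff_eq_add']
    exact hk
  have := hμ ⟨k, hkpos⟩ (by
    rw [hk']
    obtain ⟨c, hc⟩ := hi.exists_nat_coeff
    rw [PosRoot.wt, hc]
    exact sum_mem fun j hj => nsmul_mem
      (AddSubmonoid.subset_closure (Set.mem_range.mpr ⟨(⟨j, hj⟩ : b.support), rfl⟩)) _)
  rw [this, sub_self] at hk'
  exact PosRoot.wt_ne_zero _ hk'.symm

lemma gamma_sub_simpleRoot_ne (μ : PosRoot b) (i : b.support) (w : PosRoot b) :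
    (γ μ i).wt ≠ (simpleRoot b i).wt + w.wt := by
  intro h
  have : m μ i + 1 ∈ stringSet μ i := by
    intro k hk
    rcases Nat.lt_or_ge k (m μ i + 1) with hlt | hge
    · exact (isGreatest_m μ i).1 k (by lia)
    · obtain rfl : k = m μ i + 1 := le_antisymm hk hge
      refine ⟨w, ?_⟩
      rw [γ_wt] at h
      rw [succ_nsmul, ← sub_sub, h]
      abel
  exact absurd ((isGreatest_m μ i).2 this) (by lia)

/-- As `μ` heads its `α_i`-string, `m_i` is the pairing of `μ` with the coroot of `α_i`. The string
stays among the positive roots because `μ ≠ α_i`. -/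
lemma IsMaximalRoot.gamma_eq {μ : PosRoot b} (hμ : IsMaximalRoot b μ) {i : b.support}
    (hi : μ ≠ simpleRoot b i) :
    (γ μ i).1 = (IsKilling.rootSystem H).reflectionPerm i μ.1 := by
  have hH := hμ.isHighest
  have hne : μ.1 ≠ i := fun h => hi (Subtype.ext h)
  have hset := hH.sub_nsmul_mem_range_iff i.2 hne
  have hnn := hH.pairingIn_nonneg (RootPairing.Base.isPos_of_mem_support i.2)
  obtain ⟨p, hp⟩ := Int.eq_ofNat_of_zero_le hnn
  have hm : m μ i = p := by
    refine IsGreatest.unique (isGreatest_m μ i) ⟨fun k hk => ?_, fun k hk => ?_⟩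
    · obtain ⟨l, hl⟩ := (hset k).mpr (by rw [hp]; exact_mod_cast hk)
      refine ⟨⟨l, μ.2.add_zsmul hne i.2 (z := -k) ?_⟩, hl⟩
      rw [hl]
      simp [sub_eq_add_neg]
    · obtain ⟨β, hβ⟩ := hk k le_rfl
      have := (hset k).mp ⟨β.1, hβ⟩
      rw [hp] at this
      exact_mod_cast this
  apply (IsKilling.rootSystem H).root.injective
  have h1 := γ_wt μ i
  rw [RootPairing.root_reflectionPerm, RootPairing.reflection_apply_root' ℤ, hp]
  rw [hm] at h1
  change _ = (IsKilling.rootSystem H).root μ.1 - p • (IsKilling.rootSystem H).root i at h1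
  rw [natCast_zsmul]
  exact h1

namespace IsDualRootBasis

/-- The bracket with a simple root vector of an element of `𝔫` has no component along a root `δ`
such that `δ - α_i` is not a positive root. -/
lemma killingForm_f_lie_eq_zero (h : IsDualRootBasis e f) {i : b.support} {δ : PosRoot b}
    (hδ : ∀ w : PosRoot b, δ.wt ≠ (simpleRoot b i).wt + w.wt) (x : nilp b) :
    killingForm ℂ 𝔤 (f δ) ⁅(e (simpleRoot b i) : 𝔤), (x : 𝔤)⁆ = 0 := by
  have hx : (x : 𝔤) = ∑ α, killingForm ℂ 𝔤 (f α) x • (e α : 𝔤) := by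
    conv_lhs => rw [h.coe_eq_sum x]
    simp [AddSubmonoidClass.coe_finsetSum]
  rw [hx, lie_sum, map_sum]
  refine Finset.sum_eq_zero fun w _ => ?_
  have hmem : _ ∈ rootSpace H ((simpleRoot b i).wt + w.wt : Dual ℂ H) :=
    lie_mem_genWeightSpace_of_mem_genWeightSpace (h.mem (simpleRoot b i)) (h.mem w)
  rw [lie_smul, map_smul, killingForm_apply_eq_zero_of_mem_rootSpace_of_add_ne_zero ℂ 𝔤 H
    (h.mem_neg _) hmem, smul_zero]
  intro h0
  refine hδ w ?_
  ext z
  have := congrFun h0 z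
  simp only [Pi.add_apply, LinearMap.neg_apply, LinearMap.add_apply, Pi.zero_apply] at this
  rw [LinearMap.add_apply]
  linear_combination -this

/-- The weight `α_i - δ` of the bracket is nonzero and neither a positive nor a negative root. -/
lemma lie_f_simple_eq_zero (h : IsDualRootBasis e f) {i : b.support} {δ : PosRoot b}
    (hδi : δ ≠ simpleRoot b i) (hδ : ∀ w : PosRoot b, δ.wt ≠ (simpleRoot b i).wt + w.wt) :
    ⁅f δ, (e (simpleRoot b i) : 𝔤)⁆ = 0 := by
  have hmem : _ ∈ rootSpace H (-δ.wt + (simpleRoot b i).wt : Dual ℂ H) :=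
    lie_mem_genWeightSpace_of_mem_genWeightSpace (h.mem_neg δ) (h.mem (simpleRoot b i))
  by_contra hne
  have hbot : rootSpace H (-δ.wt + (simpleRoot b i).wt : Dual ℂ H) ≠ ⊥ := fun hb => hne <| by
    rwa [hb, LieSubmodule.mem_bot] at hmem
  have hne0 : -δ.wt + (simpleRoot b i).wt ≠ 0 := fun h0 => hδi (PosRoot.wt_injective
    (neg_add_eq_zero.mp h0))
  obtain ⟨w, hw | hw⟩ := exists_posRoot_of_rootSpace_ne_bot (b := b) hne0 hbot
  · exact simpleRoot_wt_ne_add i δ w (by rw [← hw]; abel)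
  · exact hδ w (by rw [← neg_eq_iff_eq_neg.mpr hw]; abel)

/-- A cocycle without components along `e_i ⊗ f^i` and `e_{γ_i} ⊗ f^i` is a coboundary. -/
lemma exists_eq_lie (h : IsDualRootBasis e f) {μ : PosRoot b} (hμ : IsMaximalRoot b μ)
    (hμs : ∀ i, μ ≠ simpleRoot b i) (D : AdjointCohomology.C1 ℂ (nilp b))
    (hD : ∀ x y, D ⁅x, y⁆ = ⁅x, D y⁆ - ⁅y, D x⁆)
    (h1 : ∀ i, e.coord (simpleRoot b i) (D (e (simpleRoot b i))) = 0)
    (h2 : ∀ i, e.coord (γ μ i) (D (e (simpleRoot b i))) = 0) :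
    ∃ x, D = AdjointCohomology.d₀₁ ℂ (nilp b) x := by
  classical
  choose Q hQ hQ' using h.exists_sum_lie_lie_eq_smul
  set v := ∑ α, ⁅f α, (D (e α) : 𝔤)⁆ with hv
  -- If `Q w = 0` the inverse is 0 by convention. This is harmless, since then `α_i + w` is never a
  -- root and the coefficient of `e_w` plays no role below.
  set x : nilp b := ∑ w, ((Q w : ℂ)⁻¹ * killingForm ℂ 𝔤 (f w) v) • e w with hx
  have hxw : ∀ w, killingForm ℂ 𝔤 (f w) x = (Q w : ℂ)⁻¹ * killingForm ℂ 𝔤 (f w) v := by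
    intro w
    rw [← h.coord_eq, hx]
    simp [Finsupp.single_apply]
  refine ⟨x, sub_eq_zero.mp (h.eq_zero_of_simpleRoot _ (fun y z => ?_) fun i => ?_)⟩
  · change D ⁅y, z⁆ - ⁅⁅y, z⁆, x⁆ = ⁅y, D z - ⁅z, x⁆⁆ - ⁅z, D y - ⁅y, x⁆⁆
    rw [hD, lie_lie, lie_sub, lie_sub]
    abel
  refine e.ext_elem fun δ => ?_
  change e.coord δ (D (e (simpleRoot b i)) - ⁅e (simpleRoot b i), x⁆) = e.coord δ 0
  rw [map_zero, map_sub, sub_eq_zero]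
  obtain ⟨K, hK, hK'⟩ := h.exists_laplacian_eq_smul i δ
  have hlap : killingForm ℂ 𝔤 (f δ) ⁅(e (simpleRoot b i) : 𝔤), v⁆ =
      K * e.coord δ (D (e (simpleRoot b i))) := by
    rw [hv, h.lie_sum_eq_laplacian D hD, h.killingForm_laplacian hK, h.coord_eq]
  rw [h.coord_eq δ ⁅e (simpleRoot b i), x⁆, LieSubalgebra.coe_bracket]
  by_cases hw : ∃ w : PosRoot b, δ.wt = (simpleRoot b i).wt + w.wt
  · obtain ⟨w, hw⟩ := hw
    have hKQ := h.laplacian_eigenvalue_eq hw (hQ w) hK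
    have hQ0 : (Q w : ℂ) ≠ 0 := by
      intro h0
      have := hQ' w (by exact_mod_cast h0) (simpleRoot b i)
      rw [← hw] at this
      exact δ.rootSpace_ne_bot this
    have hmem : ⁅f δ, (e (simpleRoot b i) : 𝔤)⁆ ∈ rootSpace H (-w.wt : Dual ℂ H) := by
      have : (-w.wt : Dual ℂ H) = -δ.wt + (simpleRoot b i).wt := by rw [hw]; abel
      rw [this]
      exact lie_mem_genWeightSpace_of_mem_genWeightSpace (h.mem_neg δ) (h.mem _)
    -- Writing `[f_δ, e_i] = t f_w`, the `δ`-components of `[e_i, v]` and `[e_i, x]` are `t v_w` and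
    -- `t v_w / Q w`; the former is also `K` times that of `D e_i`, and `K = Q w`.
    have ht := h.eq_smul_neg hmem
    set t := killingForm ℂ 𝔤 (e w) ⁅f δ, (e (simpleRoot b i) : 𝔤)⁆
    rw [← LieModule.traceForm_apply_lie_apply, ht, map_smul, LinearMap.smul_apply] at hlap ⊢
    rw [hxw, ← hKQ] at *
    rw [smul_eq_mul] at *
    field_simp
    linear_combination -hlap
  · push Not at hw
    rw [h.killingForm_f_lie_eq_zero hw]
    by_cases hδi : δ = simpleRoot b i
    · rw [hδi, h1]
    by_cases hδγ : δ = γ μ i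
    · rw [hδγ, h2]
    -- Here `[e_i, v]` has no `δ`-component, so `K` times the coordinate of `D e_i` is zero, and `K
    -- = 0` would force `δ = s_i μ = γ_i`.
    rw [← LieModule.traceForm_apply_lie_apply, h.lie_f_simple_eq_zero hδi hw, map_zero,
      LinearMap.zero_apply] at hlap
    refine (mul_eq_zero.mp hlap.symm).resolve_left fun hK0 => hδγ (Subtype.ext ?_)
    obtain ⟨hadd, hsub⟩ := hK' (by exact_mod_cast hK0)
    rw [hμ.gamma_eq (hμs i)]
    refine hμ.isHighest.eq_reflectionPerm i.2 δ.2 (fun h => hδi (Subtype.ext h)) ?_ ?_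
    · intro α hα hαi
      rw [add_comm]
      exact (rootSpace_add_eq_bot_iff ⟨α, hα⟩ δ).mp
        (hadd ⟨α, hα⟩ fun h => hαi (congrArg Subtype.val h))
    · exact (rootSpace_sub_eq_bot_iff hδi).mp hsub

end IsDualRootBasis

end MaxNilpotent

/-! ### Cocycles as derivations -/

namespace AdjointCohomology

variable {R L : Type*} [CommRing R] [LieRing L] [LieAlgebra R L]

lemma mem_Z1_iff {D : C1 R L} : D ∈ Z1 R L ↔ ∀ x y, D ⁅x, y⁆ = ⁅x, D y⁆ - ⁅y, D x⁆ := by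
  change LieModule.Cohomology.d₁₂ R L L D = 0 ↔ _
  constructor
  · intro h x y
    have := LieModule.Cohomology.d₁₂_apply_apply R L L D x y
    rw [h] at this
    exact (sub_eq_zero.mp this.symm).symm
  · intro h
    ext x y
    change ⁅x, D y⁆ - ⁅y, D x⁆ - D ⁅x, y⁆ = 0
    rw [h, sub_self]

lemma mem_Z1_of_basis {ι : Type*} (e : Basis ι R L) {D : C1 R L}
    (h : ∀ i j, D ⁅e i, e j⁆ = ⁅e i, D (e j)⁆ - ⁅e j, D (e i)⁆) : D ∈ Z1 R L := by
  rw [mem_Z1_iff]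
  intro x y
  induction e.mem_span x using Submodule.span_induction with
  | zero => simp
  | add x x' _ _ hx hx' => rw [add_lie, map_add, hx, hx', map_add, lie_add, add_lie]; abel
  | smul t x _ hx => rw [smul_lie, map_smul, hx, map_smul, lie_smul, smul_lie, smul_sub]
  | mem x hx =>
    obtain ⟨i, rfl⟩ := hx
    induction e.mem_span y using Submodule.span_induction with
    | zero => simp
    | add x x' _ _ hx hx' => rw [lie_add, map_add, hx, hx', map_add, lie_add, add_lie]; abel
    | smul t x _ hx => rw [lie_smul, map_smul, hx, map_smul, lie_smul, smul_lie, smul_sub]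
    | mem y hy =>
      obtain ⟨j, rfl⟩ := hy
      exact h i j

lemma mem_B1_iff {D : Z1 R L} : D ∈ B1 R L ↔ ∃ x, (D : C1 R L) = d₀₁ R L x :=
  ⟨fun ⟨x, hx⟩ => ⟨x, hx.symm⟩, fun ⟨x, hx⟩ => ⟨x, hx.symm⟩⟩

lemma lie_cls {f g : C1 R L} (hf : f ∈ Z1 R L) (hg : g ∈ Z1 R L) :
    ⁅cls f hf, cls g hg⁆ = cls ⁅f, g⁆ ((Z1 R L).lie_mem hf hg) := rfl

lemma cls_eq_zero_iff {f : C1 R L} (hf : f ∈ Z1 R L) :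
    cls f hf = 0 ↔ ∃ x, f = d₀₁ R L x := by
  rw [cls, LieSubmodule.Quotient.mk_eq_zero', mem_B1_iff]

end AdjointCohomology

/-! ### The cocycles `c_i`, `b_i`, their components and brackets -/

namespace MaxNilpotent

variable {𝔤 : Type*} [LieRing 𝔤] [LieAlgebra ℂ 𝔤] [FiniteDimensional ℂ 𝔤] [IsSimple ℂ 𝔤]
  {H : LieSubalgebra ℂ 𝔤} [H.IsCartanSubalgebra] {b : (IsKilling.rootSystem H).Base}
  {e : Basis (PosRoot b) ℂ (nilp b)} {f : PosRoot b → 𝔤}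

lemma exists_lie_basis_eq (he : ∀ α, (e α : 𝔤) ∈ rootSpace H α.wt) (α β : PosRoot b) :
    ⁅e α, e β⁆ = 0 ∨ ∃ γ : PosRoot b, γ.wt = α.wt + β.wt ∧ ∃ k : ℂ, ⁅e α, e β⁆ = k • e γ := by
  by_cases h : α.wt + β.wt ∈ Set.range (IsKilling.rootSystem H).root
  · obtain ⟨k, hk⟩ := h
    let γ : PosRoot b := ⟨k, α.2.add β.2 hk⟩
    have hγ : γ.wt = α.wt + β.wt := hk
    have hmem : ⁅(e α : 𝔤), (e β : 𝔤)⁆ ∈ rootSpace H γ.wt := by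
      rw [hγ]
      exact lie_mem_genWeightSpace_of_mem_genWeightSpace (he α) (he β)
    obtain ⟨c, hc⟩ := IsKilling.exists_smul_eq_of_mem_rootSpace γ.isNonZero (he γ)
      (basis_coe_ne_zero e γ) hmem
    exact Or.inr ⟨γ, hγ, c, Subtype.ext hc⟩
  · left
    have hmem : ⁅(e α : 𝔤), (e β : 𝔤)⁆ ∈ rootSpace H (α.wt + β.wt : Dual ℂ H) :=
      lie_mem_genWeightSpace_of_mem_genWeightSpace (he α) (he β)
    rw [(rootSpace_add_eq_bot_iff α β).mpr h, LieSubmodule.mem_bot] at hmem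
    exact Subtype.ext hmem

lemma elem_apply [DecidableEq (PosRoot b)] (β α γ : PosRoot b) :
    elem e β α (e γ) = if γ = α then e β else 0 := by
  change e.coord α (e γ) • e β = _
  simp [Finsupp.single_apply]

lemma c_apply (i : b.support) (α : PosRoot b) : c e i (e α) = A b i α.wt • e α := by
  classical
  simp only [c, LinearMap.sum_apply, LinearMap.smul_apply, elem_apply]
  simp

lemma bb_apply [DecidableEq (PosRoot b)] (μ : PosRoot b) (i : b.support) (α : PosRoot b) :
    bb e μ i (e α) = if α = simpleRoot b i then e (γ μ i) else 0 :=
  elem_apply _ _ _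

lemma A_add (i : b.support) (χ ψ : Dual ℂ H) : A b i (χ + ψ) = A b i χ + A b i ψ := by
  simp [A]

lemma A_sub (i : b.support) (χ ψ : Dual ℂ H) : A b i (χ - ψ) = A b i χ - A b i ψ := by
  simp [A]

lemma A_nsmul (i : b.support) (n : ℕ) (χ : Dual ℂ H) : A b i (n • χ) = n * A b i χ := by
  simp [A]

lemma A_simpleRoot [DecidableEq b.support] (i j : b.support) :
    A b i (simpleRoot b j).wt = if j = i then 1 else 0 := by
  have : (simpleRoot b j).wt = b.toWeightBasis j := by
    rw [RootPairing.Base.toWeightBasis_apply]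
    rfl
  rw [A, this, Basis.repr_self, Finsupp.single_apply]

lemma simpleRoot_injective : Function.Injective (simpleRoot b) := fun _ _ h =>
  Subtype.ext (congrArg (fun α : PosRoot b => α.1) h)

/-- The diagonal cochains `c_i` are cocycles. -/
lemma c_mem_Z1 (he : ∀ α, (e α : 𝔤) ∈ rootSpace H α.wt) (i : b.support) :
    c e i ∈ AdjointCohomology.Z1 ℂ (nilp b) := by
  refine AdjointCohomology.mem_Z1_of_basis e fun α β => ?_
  rw [c_apply, c_apply, lie_smul, lie_smul, ← lie_skew (e β) (e α), smul_neg, sub_neg_eq_add,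
    ← add_smul]
  rcases exists_lie_basis_eq he α β with h | ⟨γ, hγ, k, h⟩
  · simp [h]
  · rw [h, map_smul, c_apply, hγ, A_add, smul_comm, add_comm]

section Maximal

variable {μ : PosRoot b}

/-- From `s_i μ = α_i` it would follow that `μ = -α_i`. -/
lemma IsMaximalRoot.gamma_ne (hμ : IsMaximalRoot b μ) (hμs : ∀ i, μ ≠ simpleRoot b i)
    (i : b.support) : γ μ i ≠ simpleRoot b i := by
  intro h
  have h1 := hμ.gamma_eq (hμs i)
  rw [h] at h1
  have h2 := congrArg (IsKilling.rootSystem H).root h1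
  rw [RootPairing.root_reflectionPerm] at h2
  have h3 := congrArg ((IsKilling.rootSystem H).reflection i) h2
  rw [RootPairing.reflection_same] at h3
  refine μ.2.root_ne_neg (simpleRoot b i).2 (h3.symm.trans ?_)
  exact RootPairing.reflection_apply_self _ _

/-- The cochains `b_i` are cocycles. -/
lemma bb_mem_Z1 (he : ∀ α, (e α : 𝔤) ∈ rootSpace H α.wt) (hμ : IsMaximalRoot b μ)
    (hμs : ∀ i, μ ≠ simpleRoot b i) (i : b.support) :
    bb e μ i ∈ AdjointCohomology.Z1 ℂ (nilp b) := by
  classical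
  have hlie : ∀ α, α ≠ simpleRoot b i → ⁅e α, e (γ μ i)⁆ = 0 := by
    intro α hα
    refine (exists_lie_basis_eq he α (γ μ i)).resolve_right ?_
    rintro ⟨δ, hδ, -⟩
    refine hμ.isHighest.reflectionPerm_add_notMem i.2 α.2 (fun h => hα (Subtype.ext h)) ⟨δ.1, ?_⟩
    rw [← hμ.gamma_eq (hμs i), add_comm]
    exact hδ
  refine AdjointCohomology.mem_Z1_of_basis e fun α β => ?_
  -- Commutators have no simple components. With `hlie`, both sides of the cocycle identity vanish,
  -- the pair `α = β = α_i` being trivial.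
  have h0 : bb e μ i ⁅e α, e β⁆ = 0 := by
    rcases exists_lie_basis_eq he α β with h | ⟨δ, hδ, k, h⟩
    · simp [h]
    · rw [h, map_smul, bb_apply, if_neg, smul_zero]
      rintro rfl
      exact simpleRoot_wt_ne_add i α β hδ
  rw [h0, bb_apply, bb_apply, eq_comm, sub_eq_zero]
  split_ifs with h1 h2 h2
  · rw [h1, h2]
  · rw [hlie α h2, lie_zero]
  · rw [hlie β h1, lie_zero]
  · rw [lie_zero, lie_zero]

/-- The components of a cocycle along `e_i ⊗ f^i` and `e_{γ_i} ⊗ f^i`. -/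
def components (e : Basis (PosRoot b) ℂ (nilp b)) (μ : PosRoot b) :
    AdjointCohomology.Z1 ℂ (nilp b) →ₗ[ℂ] (b.support ⊕ b.support → ℂ) where
  toFun D := Sum.elim (fun i => e.coord (simpleRoot b i) (D.1 (e (simpleRoot b i))))
    (fun i => e.coord (γ μ i) (D.1 (e (simpleRoot b i))))
  map_add' D D' := by
    ext (i | i)
    · exact map_add (e.coord _) _ _
    · exact map_add (e.coord _) _ _
  map_smul' t D := by
    ext (i | i)
    · exact map_smul (e.coord _) _ _
    · exact map_smul (e.coord _) _ _

/-- Coboundaries lie in the kernel because neither `α_i` nor `γ_i` is `α_i` plus a positive root;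
the other inclusion is `exists_eq_lie`. -/
lemma ker_components (he : ∀ α, (e α : 𝔤) ∈ rootSpace H α.wt) (hμ : IsMaximalRoot b μ)
    (hμs : ∀ i, μ ≠ simpleRoot b i) :
    LinearMap.ker (components e μ) = (AdjointCohomology.B1 ℂ (nilp b)).toSubmodule := by
  obtain ⟨f, h⟩ := exists_isDualRootBasis he
  ext D
  rw [LinearMap.mem_ker, LieSubmodule.mem_toSubmodule, AdjointCohomology.mem_B1_iff]
  constructor
  · intro hD
    exact h.exists_eq_lie hμ hμs D.1 (AdjointCohomology.mem_Z1_iff.mp D.2)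
      (fun i => congrFun hD (Sum.inl i)) (fun i => congrFun hD (Sum.inr i))
  · rintro ⟨x, hx⟩
    ext (i | i)
    · change e.coord (simpleRoot b i) (D.1 (e (simpleRoot b i))) = 0
      rw [h.coord_eq, hx]
      refine h.killingForm_f_lie_eq_zero (fun w hw => w.wt_ne_zero ?_) x
      rwa [left_eq_add] at hw
    · change e.coord (γ μ i) (D.1 (e (simpleRoot b i))) = 0
      rw [h.coord_eq, hx]
      exact h.killingForm_f_lie_eq_zero (fun w => gamma_sub_simpleRoot_ne μ i w) x

lemma components_c [DecidableEq b.support] (hμ : IsMaximalRoot b μ)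
    (hμs : ∀ i, μ ≠ simpleRoot b i) (i : b.support)
    (hc : c e i ∈ AdjointCohomology.Z1 ℂ (nilp b)) :
    components e μ ⟨c e i, hc⟩ = Pi.single (Sum.inl i) 1 := by
  ext (j | j)
  · change e.coord (simpleRoot b j) (c e i (e (simpleRoot b j))) = _
    rw [c_apply, A_simpleRoot]
    split_ifs with h <;> simp [h]
  · change e.coord (γ μ j) (c e i (e (simpleRoot b j))) = _
    rw [c_apply]
    simp [(hμ.gamma_ne hμs j).symm]

lemma components_bb [DecidableEq b.support] (hμ : IsMaximalRoot b μ)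
    (hμs : ∀ i, μ ≠ simpleRoot b i) (i : b.support)
    (hb : bb e μ i ∈ AdjointCohomology.Z1 ℂ (nilp b)) :
    components e μ ⟨bb e μ i, hb⟩ = Pi.single (Sum.inr i) 1 := by
  classical
  ext (j | j)
  · change e.coord (simpleRoot b j) (bb e μ i (e (simpleRoot b j))) = _
    rw [bb_apply]
    split_ifs with h
    · obtain rfl := simpleRoot_injective h
      simp [hμ.gamma_ne hμs]
    · simp
  · change e.coord (γ μ j) (bb e μ i (e (simpleRoot b j))) = _
    rw [bb_apply]
    split_ifs with h
    · obtain rfl := simpleRoot_injective h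
      simp
    · have : j ≠ i := fun h' => h (by rw [h'])
      simp [this]

/-- The components of cocycles identify the first cohomology of `𝔫` with a space of functions. -/
lemma exists_equiv_cls_eq_components (he : ∀ α, (e α : 𝔤) ∈ rootSpace H α.wt)
    (hμ : IsMaximalRoot b μ) (hμs : ∀ i, μ ≠ simpleRoot b i) :
    ∃ E : AdjointCohomology.H1 ℂ (nilp b) ≃ₗ[ℂ] (b.support ⊕ b.support → ℂ),
      ∀ (D : AdjointCohomology.C1 ℂ (nilp b)) (hD : D ∈ AdjointCohomology.Z1 ℂ (nilp b)),
        E (AdjointCohomology.cls D hD) = components e μ ⟨D, hD⟩ := by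
  classical
  have hker := ker_components he hμ hμs
  have hsurj : Function.Surjective (components e μ) := by
    rw [← LinearMap.range_eq_top, eq_top_iff, ← (Pi.basisFun ℂ (b.support ⊕ b.support)).span_eq,
      Submodule.span_le]
    rintro _ ⟨i | i, rfl⟩
    · have hc := c_mem_Z1 he i
      exact ⟨_, (components_c hμ hμs i hc).trans (Pi.basisFun_apply _ _ _).symm⟩
    · have hb := bb_mem_Z1 he hμ hμs i
      exact ⟨_, (components_bb hμ hμs i hb).trans (Pi.basisFun_apply _ _ _).symm⟩
  exact ⟨(Submodule.quotEquivOfEq _ _ hker.symm).trans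
    ((components e μ).quotKerEquivOfSurjective hsurj), fun D hD => rfl⟩

/-- The cochain `b_i` has weight `γ_i - α_i`. -/
lemma isOfWeight_bb (he : ∀ α, (e α : 𝔤) ∈ rootSpace H α.wt) (i : b.support) :
    IsOfWeight ((γ μ i).wt - (simpleRoot b i).wt) (bb e μ i) := by
  classical
  intro α x hx
  obtain ⟨k, hk⟩ := IsKilling.exists_smul_eq_of_mem_rootSpace α.isNonZero (he α)
    (basis_coe_ne_zero e α) hx
  have hx' : x = k • e α := Subtype.ext hk
  rw [hx', map_smul, bb_apply]
  split_ifs with h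
  · rw [h, add_sub_cancel]
    exact Submodule.smul_mem _ _ (he _)
  · rw [smul_zero]
    exact zero_mem _

lemma lie_c_c (i j : b.support) : ⁅c e i, c e j⁆ = 0 := by
  refine e.ext fun α => ?_
  change c e i (c e j (e α)) - c e j (c e i (e α)) = 0
  rw [c_apply, c_apply, map_smul, map_smul, c_apply, c_apply, smul_comm, sub_self]

lemma lie_c_bb (i j : b.support) :
    ⁅c e i, bb e μ j⁆ = A b i ((γ μ j).wt - (simpleRoot b j).wt) • bb e μ j := by
  classical
  refine e.ext fun α => ?_
  change c e i (bb e μ j (e α)) - bb e μ j (c e i (e α)) =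
    A b i ((γ μ j).wt - (simpleRoot b j).wt) • bb e μ j (e α)
  rw [c_apply, map_smul, bb_apply]
  split_ifs with h
  · rw [c_apply, h, A_sub, sub_smul]
  · simp

/-- The bracket of the classes of `b_i` and `b_j` vanishes except if each of the roots `α_i`,
`α_j` is the `γ` of the other. -/
lemma cls_lie_bb_eq_zero (he : ∀ α, (e α : 𝔤) ∈ rootSpace H α.wt) (hμ : IsMaximalRoot b μ)
    (hμs : ∀ i, μ ≠ simpleRoot b i) (i j : b.support)
    (hij : ¬ (γ μ i = simpleRoot b j ∧ γ μ j = simpleRoot b i))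
    (hi : bb e μ i ∈ AdjointCohomology.Z1 ℂ (nilp b))
    (hj : bb e μ j ∈ AdjointCohomology.Z1 ℂ (nilp b)) :
    ⁅AdjointCohomology.cls (bb e μ i) hi, AdjointCohomology.cls (bb e μ j) hj⁆ = 0 := by
  classical
  have hne := hμ.gamma_ne hμs
  obtain ⟨E, hE⟩ := exists_equiv_cls_eq_components he hμ hμs
  apply E.injective
  rw [AdjointCohomology.lie_cls, hE, map_zero]
  have hcoord : ∀ α β : PosRoot b, β ≠ α → e.coord α (e β) = 0 := fun α β h => by simp [h]
  -- The commutator need not vanish as a cochain: the product `b_i b_j` is `e_{γ_i} ⊗ f^{α_j}` when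
  -- `γ_j = α_i`. A component of it would need `γ_i = α_j`, excluded by `hij`, or `γ_i = γ_j = α_i`,
  -- excluded by `hne`.
  have h1 : ∀ k p, p = simpleRoot b k ∨ p = γ μ k →
      e.coord p (bb e μ i (bb e μ j (e (simpleRoot b k)))) = 0 := by
    intro k p hp
    rw [bb_apply]
    split_ifs with hkj
    · rw [bb_apply]
      split_ifs with hji
      · obtain rfl := simpleRoot_injective hkj
        refine hcoord _ _ ?_
        rintro rfl
        exact hp.elim (fun h => hij ⟨h, hji⟩) (fun h => hne i (h.trans hji))
      · exact map_zero _
    · rw [map_zero, map_zero]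
  have h2 : ∀ k p, p = simpleRoot b k ∨ p = γ μ k →
      e.coord p (bb e μ j (bb e μ i (e (simpleRoot b k)))) = 0 := by
    intro k p hp
    rw [bb_apply]
    split_ifs with hki
    · rw [bb_apply]
      split_ifs with hij'
      · obtain rfl := simpleRoot_injective hki
        refine hcoord _ _ ?_
        rintro rfl
        exact hp.elim (fun h => hij ⟨hij', h⟩) (fun h => hne j (h.trans hij'))
      · exact map_zero _
    · rw [map_zero, map_zero]
  have h3 : ∀ k p, p = simpleRoot b k ∨ p = γ μ k →
      e.coord p (⁅bb e μ i, bb e μ j⁆ (e (simpleRoot b k))) = 0 := by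
    intro k p hp
    change e.coord p (bb e μ i (bb e μ j (e (simpleRoot b k))) -
      bb e μ j (bb e μ i (e (simpleRoot b k)))) = 0
    rw [map_sub, h1 k p hp, h2 k p hp, sub_zero]
  ext (k | k)
  · exact h3 k _ (Or.inl rfl)
  · exact h3 k _ (Or.inr rfl)

lemma eq_add_of_gamma_eq {i j : b.support} (hne : i ≠ j) (h1 : γ μ i = simpleRoot b j)
    (h2 : γ μ j = simpleRoot b i) : μ.wt = (simpleRoot b i).wt + (simpleRoot b j).wt := by
  classical
  have h1' := γ_wt μ i
  have h2' := γ_wt μ j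
  rw [h1] at h1'
  rw [h2] at h2'
  have h3 : μ.wt = (simpleRoot b j).wt + m μ i • (simpleRoot b i).wt := by rw [h1']; abel
  have h4 : μ.wt = (simpleRoot b i).wt + m μ j • (simpleRoot b j).wt := by rw [h2']; abel
  have h5 := congrArg (A b i) (h3.symm.trans h4)
  simp only [A_add, A_nsmul, A_simpleRoot, hne.symm, if_true, if_false, mul_one, mul_zero,
    add_zero, zero_add] at h5
  have h6 : m μ i = 1 := by exact_mod_cast h5
  rw [h3, h6, one_smul, add_comm]

end Maximal

end MaxNilpotent

/-! ### Recognition of 𝔰𝔩₂ and 𝔰𝔩₃ -/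

namespace LieAlgebra.SpecialLinear

/-- A homomorphism from `𝔰𝔩ₙ` which does not kill any off-diagonal matrix unit is injective. -/
lemma injective_of_single_ne_zero {n K L : Type*} [Fintype n] [DecidableEq n] [Nonempty n]
    [Field K] [CharZero K] [LieRing L] [LieAlgebra K L] (φ : sl n K →ₗ⁅K⁆ L)
    (h : ∀ (i j : n) (hij : i ≠ j), φ (single i j hij 1) ≠ 0) : Function.Injective φ := by
  rw [injective_iff_map_eq_zero]
  intro M hM
  have hoff : ∀ i j, i ≠ j → M.1 j i = 0 := by
    intro i j hij
    -- The kernel is an ideal, and the double bracket with a matrix unit isolates one off-diagonal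
    -- entry of `M`.
    have key : ⁅single i j hij (1 : K), ⁅single i j hij (1 : K), M⁆⁆ =
        (-(2 * M.1 j i)) • single i j hij (1 : K) := by
      have h2 : Matrix.single i j (1 : K) * Matrix.single i j 1 = 0 :=
        Matrix.single_mul_single_of_ne _ _ _ _ hij.symm _
      have h3 : Matrix.single i j (1 : K) * M.1 * Matrix.single i j 1 =
          M.1 j i • Matrix.single i j 1 := by
        rw [Matrix.single_mul_mul_single, Matrix.smul_single]
        simp
      apply Subtype.ext
      rw [sl_bracket, sl_bracket]
      change Matrix.single i j (1 : K) * (Matrix.single i j 1 * M.1 - M.1 * Matrix.single i j 1) -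
        (Matrix.single i j 1 * M.1 - M.1 * Matrix.single i j 1) * Matrix.single i j 1 =
        (-(2 * M.1 j i)) • Matrix.single i j 1
      rw [Matrix.mul_sub, Matrix.sub_mul, ← Matrix.mul_assoc, ← Matrix.mul_assoc, h3, h2,
        Matrix.mul_assoc M.1, h2, Matrix.zero_mul, Matrix.mul_zero]
      module
    have := congrArg φ key
    rw [LieHom.map_lie, LieHom.map_lie, hM, lie_zero, lie_zero, map_smul, eq_comm,
      smul_eq_zero] at this
    simpa using this.resolve_right (h i j hij)
  have hdiag : ∀ i j, M.1 i i = M.1 j j := by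
    intro i j
    by_cases hij : i = j
    · rw [hij]
    have key : ⁅single i j hij (1 : K), M⁆ =
        (M.1 j j - M.1 i i) • single i j hij (1 : K) := by
      apply Subtype.ext
      rw [sl_bracket]
      change Matrix.single i j (1 : K) * M.1 - M.1 * Matrix.single i j 1 =
        (M.1 j j - M.1 i i) • Matrix.single i j 1
      ext k l
      simp only [Matrix.sub_apply, Matrix.smul_apply, smul_eq_mul]
      rw [Matrix.mul_apply, Matrix.mul_apply]
      simp only [Matrix.single_apply, ite_mul, mul_ite, one_mul, mul_one, zero_mul, mul_zero,
        ite_and, Finset.sum_ite_irrel, Finset.sum_ite_eq, Finset.mem_univ, if_true,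
        Finset.sum_const_zero]
      by_cases hk : i = k <;> by_cases hl : j = l
      · subst hk hl; simp
      · subst hk; simp [hl, hoff l j (Ne.symm hl)]
      · subst hl; simp [hk, hoff i k hk]
      · simp [hk, hl]
    have := congrArg φ key
    rw [LieHom.map_lie, hM, lie_zero, map_smul, eq_comm, smul_eq_zero] at this
    exact (sub_eq_zero.mp (this.resolve_right (h i j hij))).symm
  have htr : Matrix.trace M.1 = 0 := M.2
  obtain ⟨k⟩ := ‹Nonempty n›
  rw [Matrix.trace, Finset.sum_congr rfl fun i _ => show M.1.diag i = M.1 k k from hdiag i k] at htr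
  have hk : M.1 k k = 0 := by simpa using htr
  apply Subtype.ext
  ext i j
  by_cases hij : i = j
  · rw [hij, hdiag j k, hk]; rfl
  · exact hoff j i (Ne.symm hij)

/-- The homomorphism from `𝔰𝔩₂` determined by an `𝔰𝔩₂`-triple. -/
lemma exists_lieHom_of_isSl2Triple {R L : Type*} [CommRing R] [LieRing L] [LieAlgebra R L]
    {h e f : L} (t : IsSl2Triple h e f) :
    ∃ φ : sl (Fin 2) R →ₗ⁅R⁆ L, ∀ M, φ M = M.1 0 1 • e + M.1 1 0 • f + M.1 0 0 • h := by
  refine ⟨{ toFun := fun M => M.1 0 1 • e + M.1 1 0 • f + M.1 0 0 • h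
            map_add' := fun M N => ?_
            map_smul' := fun r M => ?_
            map_lie' := fun {M N} => ?_ }, fun M => rfl⟩
  · simp only [AddMemClass.coe_add, Matrix.add_apply]
    module
  · simp only [SetLike.val_smul, Matrix.smul_apply, smul_eq_mul, RingHom.id_apply]
    module
  · have hef := t.lie_e_f
    have hhe := t.lie_h_e_nsmul
    have hhf := t.lie_h_f_nsmul
    have hfe : ⁅f, e⁆ = -h := by rw [← hef, lie_skew]
    have heh : ⁅e, h⁆ = -(2 • e) := by rw [← hhe, lie_skew]
    have hfh : ⁅f, h⁆ = 2 • f := by rw [← lie_skew, hhf, neg_neg]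
    have hM : M.1 1 1 = -M.1 0 0 := by
      have : Matrix.trace M.1 = 0 := M.2
      rw [Matrix.trace_fin_two] at this
      linear_combination this
    have hN : N.1 1 1 = -N.1 0 0 := by
      have : Matrix.trace N.1 = 0 := N.2
      rw [Matrix.trace_fin_two] at this
      linear_combination this
    simp only [sl_bracket, Matrix.sub_apply, Matrix.mul_apply, Fin.sum_univ_two, hM, hN, add_lie,
      lie_add, smul_lie, lie_smul, lie_self, hef, hhe, hhf, hfe, heh, hfh]
    module

/-- The homomorphism from `𝔰𝔩₃` determined by two `𝔰𝔩₂`-triples satisfying Serre's relations. -/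
lemma exists_lieHom_of_serre {R L : Type*} [CommRing R] [LieRing L] [LieAlgebra R L]
    {h₁ e₁ f₁ h₂ e₂ f₂ : L} (t₁ : IsSl2Triple h₁ e₁ f₁) (t₂ : IsSl2Triple h₂ e₂ f₂)
    (hh : ⁅h₁, h₂⁆ = 0) (h₁e₂ : ⁅h₁, e₂⁆ = -e₂) (h₂e₁ : ⁅h₂, e₁⁆ = -e₁) (h₁f₂ : ⁅h₁, f₂⁆ = f₂)
    (h₂f₁ : ⁅h₂, f₁⁆ = f₁) (e₁f₂ : ⁅e₁, f₂⁆ = 0) (e₂f₁ : ⁅e₂, f₁⁆ = 0) (e₁e₃ : ⁅e₁, ⁅e₁, e₂⁆⁆ = 0)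
    (e₂e₃ : ⁅e₂, ⁅e₁, e₂⁆⁆ = 0) (f₁f₃ : ⁅f₁, ⁅f₂, f₁⁆⁆ = 0) (f₂f₃ : ⁅f₂, ⁅f₂, f₁⁆⁆ = 0) :
    ∃ φ : sl (Fin 3) R →ₗ⁅R⁆ L, ∀ M, φ M =
      M.1 0 1 • e₁ + M.1 1 2 • e₂ + M.1 0 2 • ⁅e₁, e₂⁆ + M.1 1 0 • f₁ + M.1 2 1 • f₂ +
      M.1 2 0 • ⁅f₂, f₁⁆ + M.1 0 0 • h₁ + (M.1 0 0 + M.1 1 1) • h₂ := by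
  obtain ⟨e₃, he₃⟩ : ∃ e₃, e₃ = ⁅e₁, e₂⁆ := ⟨_, rfl⟩
  obtain ⟨f₃, hf₃⟩ : ∃ f₃, f₃ = ⁅f₂, f₁⁆ := ⟨_, rfl⟩
  have e₁f₁ := t₁.lie_e_f
  have h₁e₁ := t₁.lie_h_e_nsmul
  have h₁f₁ := t₁.lie_h_f_nsmul
  have e₂f₂ := t₂.lie_e_f
  have h₂e₂ := t₂.lie_h_e_nsmul
  have h₂f₂ := t₂.lie_h_f_nsmul
  have f₁e₁ : ⁅f₁, e₁⁆ = -h₁ := by rw [← e₁f₁, lie_skew]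
  have e₁h₁ : ⁅e₁, h₁⁆ = -(2 • e₁) := by rw [← h₁e₁, lie_skew]
  have f₁h₁ : ⁅f₁, h₁⁆ = 2 • f₁ := by rw [← lie_skew, h₁f₁, neg_neg]
  have f₂e₂ : ⁅f₂, e₂⁆ = -h₂ := by rw [← e₂f₂, lie_skew]
  have e₂h₂ : ⁅e₂, h₂⁆ = -(2 • e₂) := by rw [← h₂e₂, lie_skew]
  have f₂h₂ : ⁅f₂, h₂⁆ = 2 • f₂ := by rw [← lie_skew, h₂f₂, neg_neg]
  have hh' : ⁅h₂, h₁⁆ = 0 := by rw [← lie_skew, hh, neg_zero]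
  have e₂h₁ : ⁅e₂, h₁⁆ = e₂ := by rw [← lie_skew, h₁e₂, neg_neg]
  have e₁h₂ : ⁅e₁, h₂⁆ = e₁ := by rw [← lie_skew, h₂e₁, neg_neg]
  have f₂h₁ : ⁅f₂, h₁⁆ = -f₂ := by rw [← lie_skew, h₁f₂]
  have f₁h₂ : ⁅f₁, h₂⁆ = -f₁ := by rw [← lie_skew, h₂f₁]
  have f₂e₁ : ⁅f₂, e₁⁆ = 0 := by rw [← lie_skew, e₁f₂, neg_zero]
  have f₁e₂ : ⁅f₁, e₂⁆ = 0 := by rw [← lie_skew, e₂f₁, neg_zero]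
  rw [← he₃] at e₁e₃ e₂e₃ ⊢
  rw [← hf₃] at f₁f₃ f₂f₃ ⊢
  have e₂e₁ : ⁅e₂, e₁⁆ = -e₃ := by rw [he₃, lie_skew]
  have f₁f₂ : ⁅f₁, f₂⁆ = -f₃ := by rw [hf₃, lie_skew]
  have e₃e₁ : ⁅e₃, e₁⁆ = 0 := by rw [← lie_skew, e₁e₃, neg_zero]
  have e₃e₂ : ⁅e₃, e₂⁆ = 0 := by rw [← lie_skew, e₂e₃, neg_zero]
  have f₃f₁ : ⁅f₃, f₁⁆ = 0 := by rw [← lie_skew, f₁f₃, neg_zero]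
  have f₃f₂ : ⁅f₃, f₂⁆ = 0 := by rw [← lie_skew, f₂f₃, neg_zero]
  have h₁e₃ : ⁅h₁, e₃⁆ = e₃ := by
    rw [he₃, leibniz_lie, h₁e₁, h₁e₂, nsmul_lie, lie_neg]; module
  have h₂e₃ : ⁅h₂, e₃⁆ = e₃ := by
    rw [he₃, leibniz_lie, h₂e₁, h₂e₂, lie_nsmul, neg_lie]; module
  have h₁f₃ : ⁅h₁, f₃⁆ = -f₃ := by
    rw [hf₃, leibniz_lie, h₁f₁, h₁f₂, lie_neg, lie_nsmul]; module
  have h₂f₃ : ⁅h₂, f₃⁆ = -f₃ := by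
    rw [hf₃, leibniz_lie, h₂f₁, h₂f₂, neg_lie, nsmul_lie]; module
  have e₁f₃ : ⁅e₁, f₃⁆ = -f₂ := by rw [hf₃, leibniz_lie, e₁f₂, zero_lie, zero_add, e₁f₁, f₂h₁]
  have e₂f₃ : ⁅e₂, f₃⁆ = f₁ := by rw [hf₃, leibniz_lie, e₂f₁, lie_zero, add_zero, e₂f₂, h₂f₁]
  have f₁e₃ : ⁅f₁, e₃⁆ = e₂ := by
    rw [he₃, leibniz_lie, f₁e₂, lie_zero, add_zero, f₁e₁, neg_lie, h₁e₂, neg_neg]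
  have f₂e₃ : ⁅f₂, e₃⁆ = -e₁ := by
    rw [he₃, leibniz_lie, f₂e₁, zero_lie, zero_add, f₂e₂, lie_neg, e₁h₂]
  have e₃f₁ : ⁅e₃, f₁⁆ = -e₂ := by rw [← lie_skew, f₁e₃]
  have e₃f₂ : ⁅e₃, f₂⁆ = e₁ := by rw [← lie_skew, f₂e₃, neg_neg]
  have f₃e₁ : ⁅f₃, e₁⁆ = f₂ := by rw [← lie_skew, e₁f₃, neg_neg]
  have f₃e₂ : ⁅f₃, e₂⁆ = -f₁ := by rw [← lie_skew, e₂f₃]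
  have e₃h₁ : ⁅e₃, h₁⁆ = -e₃ := by rw [← lie_skew, h₁e₃]
  have e₃h₂ : ⁅e₃, h₂⁆ = -e₃ := by rw [← lie_skew, h₂e₃]
  have f₃h₁ : ⁅f₃, h₁⁆ = f₃ := by rw [← lie_skew, h₁f₃, neg_neg]
  have f₃h₂ : ⁅f₃, h₂⁆ = f₃ := by rw [← lie_skew, h₂f₃, neg_neg]
  have e₃f₃ : ⁅e₃, f₃⁆ = h₁ + h₂ := by
    rw [he₃, lie_lie, e₁f₃, e₂f₃, e₁f₁, lie_neg, e₂f₂, sub_neg_eq_add]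
  have f₃e₃ : ⁅f₃, e₃⁆ = -(h₁ + h₂) := by rw [← lie_skew, e₃f₃]
  -- The diagonal coefficients come from `diag(a, b, -a-b) = a h₁ + (a + b) h₂`.
  refine ⟨{ toFun := fun M => M.1 0 1 • e₁ + M.1 1 2 • e₂ + M.1 0 2 • e₃ + M.1 1 0 • f₁ +
              M.1 2 1 • f₂ + M.1 2 0 • f₃ + M.1 0 0 • h₁ + (M.1 0 0 + M.1 1 1) • h₂
            map_add' := fun M N => ?_
            map_smul' := fun r M => ?_
            map_lie' := fun {M N} => ?_ }, fun M => rfl⟩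
  · simp only [AddMemClass.coe_add, Matrix.add_apply]
    module
  · simp only [SetLike.val_smul, Matrix.smul_apply, smul_eq_mul, RingHom.id_apply]
    module
  · have hM : M.1 2 2 = -(M.1 0 0 + M.1 1 1) := by
      have : Matrix.trace M.1 = 0 := M.2
      rw [Matrix.trace_fin_three] at this
      linear_combination this
    have hN : N.1 2 2 = -(N.1 0 0 + N.1 1 1) := by
      have : Matrix.trace N.1 = 0 := N.2
      rw [Matrix.trace_fin_three] at this
      linear_combination this
    simp only [sl_bracket, Matrix.sub_apply, Matrix.mul_apply, Fin.sum_univ_three, hM, hN, add_lie,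
      lie_add, smul_lie, lie_smul, lie_self, hh, hh', e₁f₁, e₁f₂, e₁f₃, e₂f₁, e₂f₂, e₂f₃, e₃f₁,
      e₃f₂, e₃f₃, f₁e₁, f₁e₂, f₁e₃, f₂e₁, f₂e₂, f₂e₃, f₃e₁, f₃e₂, f₃e₃, h₁e₁, h₁e₂, h₁e₃, h₂e₁,
      h₂e₂, h₂e₃, h₁f₁, h₁f₂, h₁f₃, h₂f₁, h₂f₂, h₂f₃, e₁h₁, e₁h₂, e₂h₁, e₂h₂, e₃h₁, e₃h₂, f₁h₁,
      f₁h₂, f₂h₁, f₂h₂, f₃h₁, f₃h₂, e₁e₃, e₂e₃, e₃e₁, e₃e₂, e₂e₁, ← he₃, ← hf₃, f₁f₃, f₂f₃, f₃f₁, f₃f₂,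
      f₁f₂]
    module

end LieAlgebra.SpecialLinear

/-- Here `x` is a lowest weight vector generating a two-dimensional module, whose weights are ±1. -/
lemma IsSl2Triple.eq_neg_one_of_lie_lie_eq_zero {K L : Type*} [Field K] [CharZero K] [LieRing L]
    [LieAlgebra K L] {h e f x : L} (t : IsSl2Triple h e f) {p : K} (hx : ⁅h, x⁆ = p • x)
    (fx : ⁅f, x⁆ = 0) (ex : ⁅e, x⁆ ≠ 0) (eex : ⁅e, ⁅e, x⁆⁆ = 0) : p = -1 := by
  have fe : ⁅f, e⁆ = -h := by rw [← t.lie_e_f, lie_skew]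
  have h1 : ⁅f, ⁅e, x⁆⁆ = -(p • x) := by
    rw [leibniz_lie, fx, lie_zero, add_zero, fe, neg_lie, hx]
  have h2 : ⁅h, ⁅e, x⁆⁆ = (2 + p) • ⁅e, x⁆ := by
    rw [leibniz_lie, t.lie_h_e_nsmul, hx, nsmul_lie, lie_smul]
    module
  have h3 : ⁅f, ⁅e, ⁅e, x⁆⁆⁆ = (-(2 + 2 * p)) • ⁅e, x⁆ := by
    rw [leibniz_lie, fe, neg_lie, h1, h2, lie_neg, lie_smul]
    module
  rw [eex, lie_zero, eq_comm, smul_eq_zero] at h3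
  linear_combination (-1 / 2 : K) * h3.resolve_right ex

namespace LieAlgebra.IsKilling

open LieModule

variable {K L : Type*} [Field K] [CharZero K] [LieRing L] [LieAlgebra K L]
  [IsKilling K L] [FiniteDimensional K L]
  {H : LieSubalgebra K L} [H.IsCartanSubalgebra] [IsTriangularizable K H L]

/-- A Lie subalgebra containing all root spaces is everything. -/
lemma eq_top_of_rootSpace_le {S : LieSubalgebra K L}
    (hS : ∀ α : Weight K H L, α.IsNonZero → ∀ x ∈ rootSpace H α, x ∈ S) : S = ⊤ := by
  -- The Cartan subalgebra is spanned by the brackets of opposite root vectors.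
  have hH : ∀ x : H, (x : L) ∈ S := by
    intro x
    have hx : x ∈ ⨆ α : Weight K H L, ⨆ (_ : α.IsNonZero), corootSpace α := by
      rw [biSup_corootSpace_eq_top]; exact LieSubmodule.mem_top _
    have hle : (⨆ α : Weight K H L, ⨆ (_ : α.IsNonZero), corootSpace α).toSubmodule ≤
        S.toSubmodule.comap H.toSubmodule.subtype := by
      simp only [LieSubmodule.iSup_toSubmodule, iSup_le_iff]
      intro α hα y hy
      have hy' := (LieAlgebra.mem_corootSpace (α := α)).mp hy
      suffices Submodule.span K {z | ∃ u ∈ rootSpace H α, ∃ v ∈ rootSpace H (-α), ⁅u, v⁆ = z} ≤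
        S.toSubmodule from this hy'
      refine Submodule.span_le.mpr ?_
      rintro _ ⟨u, hu, v, hv, rfl⟩
      exact S.lie_mem (hS α hα u hu) (hS (-α) hα.neg v hv)
    exact hle hx
  have hle : (H.toLieSubmodule ⊔ ⨆ α : Weight K H L, ⨆ (_ : α.IsNonZero),
      rootSpace H α).toSubmodule ≤ S.toSubmodule := by
    simp only [LieSubmodule.sup_toSubmodule, LieSubmodule.iSup_toSubmodule, sup_le_iff,
      iSup_le_iff]
    exact ⟨fun x hx => hH ⟨x, hx⟩, fun α hα x hx => hS α hα x hx⟩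
  rw [cartan_sup_iSup_rootSpace_eq_top] at hle
  exact eq_top_iff.mpr fun x _ => hle (Submodule.mem_top)

lemma rootSpace_neg_eq_bot {χ : Dual K H} (h : rootSpace H χ = ⊥) :
    rootSpace H (-χ : Dual K H) = ⊥ := by
  by_contra hne
  let w : Weight K H L := ⟨(-χ : Dual K H), hne⟩
  refine Weight.genWeightSpace_ne_bot L (-w) ?_
  have : ((-w : Weight K H L) : H → K) = χ := by
    rw [Weight.coe_neg]
    ext z
    change -(-χ) z = χ z
    simp
  rw [this]
  exact h

end LieAlgebra.IsKilling

namespace MaxNilpotent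

variable {𝔤 : Type*} [LieRing 𝔤] [LieAlgebra ℂ 𝔤] [FiniteDimensional ℂ 𝔤] [IsSimple ℂ 𝔤]
  {H : LieSubalgebra ℂ 𝔤} [H.IsCartanSubalgebra] {b : (IsKilling.rootSystem H).Base}

lemma eq_top_of_posRoot_mem (b : (IsKilling.rootSystem H).Base) {S : LieSubalgebra ℂ 𝔤}
    (hpos : ∀ α : PosRoot b, ∃ x ∈ rootSpace H α.wt, x ≠ 0 ∧ x ∈ S)
    (hneg : ∀ α : PosRoot b, ∃ x ∈ rootSpace H (-α.wt : Dual ℂ H), x ≠ 0 ∧ x ∈ S) : S = ⊤ := by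
  refine IsKilling.eq_top_of_rootSpace_le (H := H) fun α hα x hx => ?_
  obtain ⟨y, hy, hy0, hyS⟩ : ∃ y ∈ rootSpace H α, y ≠ 0 ∧ y ∈ S := by
    have hα0 : α.toLinear ≠ 0 := fun h => hα (by ext z; exact LinearMap.congr_fun h z)
    obtain ⟨γ, h | h⟩ := exists_posRoot_of_rootSpace_ne_bot (b := b) hα0 α.genWeightSpace_ne_bot
    · obtain ⟨y, hy, h0, hS⟩ := hpos γ
      rw [← h] at hy
      exact ⟨y, hy, h0, hS⟩
    · obtain ⟨y, hy, h0, hS⟩ := hneg γ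
      rw [← h] at hy
      exact ⟨y, hy, h0, hS⟩
  obtain ⟨k, rfl⟩ := IsKilling.exists_smul_eq_of_mem_rootSpace hα hy hy0 hx
  exact S.smul_mem k hyS

lemma PosRoot.exists_isSl2Triple (α : PosRoot b) : ∃ (h : H) (e f : 𝔤),
    IsSl2Triple (h : 𝔤) e f ∧ e ∈ rootSpace H α.wt ∧ f ∈ rootSpace H (-α.wt : Dual ℂ H) := by
  obtain ⟨h, e, f, t, he, hf⟩ := IsKilling.exists_isSl2Triple_of_weight_isNonZero α.isNonZero
  obtain rfl := t.h_eq_coroot α.isNonZero he hf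
  exact ⟨_, e, f, t, he, hf⟩

/-- If there is only one positive root then `𝔤` is `𝔰𝔩₂`. -/
lemma nonempty_equiv_sl2 (α : PosRoot b) (hall : ∀ β : PosRoot b, β = α) :
    Nonempty (𝔤 ≃ₗ⁅ℂ⁆ SpecialLinear.sl (Fin 2) ℂ) := by
  obtain ⟨h, e, f, t, he, hf⟩ := α.exists_isSl2Triple
  obtain ⟨φ, hφ⟩ := SpecialLinear.exists_lieHom_of_isSl2Triple (R := ℂ) t
  have h01 : φ (SpecialLinear.single 0 1 (by decide) 1) = e := by
    rw [hφ, SpecialLinear.val_single]; simp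
  have h10 : φ (SpecialLinear.single 1 0 (by decide) 1) = f := by
    rw [hφ, SpecialLinear.val_single]; simp
  have hinj : Function.Injective φ := by
    refine SpecialLinear.injective_of_single_ne_zero φ fun i j hij => ?_
    fin_cases i <;> fin_cases j
    · exact (hij rfl).elim
    · exact h01.trans_ne t.e_ne_zero
    · exact h10.trans_ne t.f_ne_zero
    · exact (hij rfl).elim
  have hsurj : Function.Surjective φ := by
    rw [← LieHom.range_eq_top]
    refine eq_top_of_posRoot_mem b (fun β => ?_) (fun β => ?_)
    · rw [hall β]
      exact ⟨e, he, t.e_ne_zero, _, h01⟩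
    · rw [hall β]
      exact ⟨f, hf, t.f_ne_zero, _, h10⟩
  exact ⟨(LieEquiv.ofBijective φ ⟨hinj, hsurj⟩).symm⟩

lemma rootSpace_simpleRoot_sub_eq_bot {i j : b.support} (hij : i ≠ j) :
    rootSpace H ((simpleRoot b i).wt + -(simpleRoot b j).wt : Dual ℂ H) = ⊥ := by
  have hne : (simpleRoot b i).wt + -(simpleRoot b j).wt ≠ 0 := by
    rw [← sub_eq_add_neg, sub_ne_zero]
    exact fun h => hij (simpleRoot_injective (PosRoot.wt_injective h))
  by_contra h
  obtain ⟨γ, h | h⟩ := exists_posRoot_of_rootSpace_ne_bot (b := b) hne h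
  · exact simpleRoot_wt_ne_add i γ (simpleRoot b j) (by rw [← h]; abel)
  · exact simpleRoot_wt_ne_add j γ (simpleRoot b i) (by rw [← neg_eq_iff_eq_neg.mpr h]; abel)

lemma lie_mem_rootSpace {χ ψ : Dual ℂ H} {x y : 𝔤} (hx : x ∈ rootSpace H χ)
    (hy : y ∈ rootSpace H ψ) : ⁅x, y⁆ ∈ rootSpace H (χ + ψ : Dual ℂ H) :=
  lie_mem_genWeightSpace_of_mem_genWeightSpace hx hy

lemma lie_eq_zero_of_rootSpace_eq_bot {χ ψ : Dual ℂ H} (h : rootSpace H (χ + ψ : Dual ℂ H) = ⊥)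
    {x y : 𝔤} (hx : x ∈ rootSpace H χ) (hy : y ∈ rootSpace H ψ) : ⁅x, y⁆ = 0 := by
  have := lie_mem_rootSpace hx hy
  rwa [h, LieSubmodule.mem_bot] at this

/-- If the positive roots are two simple roots and their sum then `𝔤` is `𝔰𝔩₃`. -/
lemma nonempty_equiv_sl3 {i j : b.support} (hij : i ≠ j) {μ : PosRoot b}
    (hμ : μ.wt = (simpleRoot b i).wt + (simpleRoot b j).wt)
    (hall : ∀ β : PosRoot b, β = simpleRoot b i ∨ β = simpleRoot b j ∨ β = μ) :
    Nonempty (𝔤 ≃ₗ⁅ℂ⁆ SpecialLinear.sl (Fin 3) ℂ) := by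
  obtain ⟨h₁, e₁, f₁, t₁, he₁, hf₁⟩ := (simpleRoot b i).exists_isSl2Triple
  obtain ⟨h₂, e₂, f₂, t₂, he₂, hf₂⟩ := (simpleRoot b j).exists_isSl2Triple
  have hbot : ∀ k, k = i ∨ k = j → rootSpace H ((simpleRoot b k).wt + μ.wt : Dual ℂ H) = ⊥ := by
    intro k hk
    rw [rootSpace_add_eq_bot_iff]
    rintro ⟨l, hl⟩
    obtain ⟨β, hl'⟩ : ∃ β : PosRoot b, β.wt = (simpleRoot b k).wt + μ.wt :=
      ⟨⟨l, (simpleRoot b k).2.add μ.2 hl⟩, hl⟩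
    rcases hall β with h | h | h <;> rw [h] at hl'
    · exact simpleRoot_wt_ne_add _ _ _ hl'
    · exact simpleRoot_wt_ne_add _ _ _ hl'
    · exact (simpleRoot b k).wt_ne_zero (by simpa using hl')
  have hbot' : ∀ k, k = i ∨ k = j →
      rootSpace H (-(simpleRoot b k).wt + -μ.wt : Dual ℂ H) = ⊥ := by
    intro k hk
    rw [← neg_add]
    exact IsKilling.rootSpace_neg_eq_bot (hbot k hk)
  have he₃ : ⁅e₁, e₂⁆ ∈ rootSpace H μ.wt := by rw [hμ]; exact lie_mem_rootSpace he₁ he₂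
  have he₃' : ⁅e₂, e₁⁆ ∈ rootSpace H μ.wt := by rw [hμ, add_comm]; exact lie_mem_rootSpace he₂ he₁
  have hf₃ : ⁅f₂, f₁⁆ ∈ rootSpace H (-μ.wt : Dual ℂ H) := by
    rw [hμ, add_comm, neg_add]; exact lie_mem_rootSpace hf₂ hf₁
  have he₃0 : ⁅e₁, e₂⁆ ≠ 0 := by
    refine IsKilling.lie_ne_zero_of_mem_rootSpace (simpleRoot b i).isNonZero
      (simpleRoot b j).isNonZero ?_ he₁ t₁.e_ne_zero he₂ t₂.e_ne_zero
    have := μ.rootSpace_ne_bot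
    rwa [hμ] at this
  have he₃0' : ⁅e₂, e₁⁆ ≠ 0 := by rwa [← lie_skew, neg_ne_zero]
  have hf₃0 : ⁅f₂, f₁⁆ ≠ 0 := by
    refine IsKilling.lie_ne_zero_of_mem_rootSpace (α := -(simpleRoot b j).1.1)
      (β := -(simpleRoot b i).1.1) (simpleRoot b j).isNonZero.neg
      (simpleRoot b i).isNonZero.neg ?_ hf₂ t₂.f_ne_zero hf₁ t₁.f_ne_zero
    have h1 : rootSpace H (-μ.wt : Dual ℂ H) ≠ ⊥ := (-μ.1.1).genWeightSpace_ne_bot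
    rwa [hμ, add_comm, neg_add] at h1
  have e₁f₂ : ⁅e₁, f₂⁆ = 0 :=
    lie_eq_zero_of_rootSpace_eq_bot (rootSpace_simpleRoot_sub_eq_bot hij) he₁ hf₂
  have e₂f₁ : ⁅e₂, f₁⁆ = 0 :=
    lie_eq_zero_of_rootSpace_eq_bot (rootSpace_simpleRoot_sub_eq_bot hij.symm) he₂ hf₁
  have e₁e₃ : ⁅e₁, ⁅e₁, e₂⁆⁆ = 0 :=
    lie_eq_zero_of_rootSpace_eq_bot (hbot i (Or.inl rfl)) he₁ he₃
  have e₂e₃ : ⁅e₂, ⁅e₁, e₂⁆⁆ = 0 :=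
    lie_eq_zero_of_rootSpace_eq_bot (hbot j (Or.inr rfl)) he₂ he₃
  have e₂e₃' : ⁅e₂, ⁅e₂, e₁⁆⁆ = 0 :=
    lie_eq_zero_of_rootSpace_eq_bot (hbot j (Or.inr rfl)) he₂ he₃'
  have f₁f₃ : ⁅f₁, ⁅f₂, f₁⁆⁆ = 0 :=
    lie_eq_zero_of_rootSpace_eq_bot (hbot' i (Or.inl rfl)) hf₁ hf₃
  have f₂f₃ : ⁅f₂, ⁅f₂, f₁⁆⁆ = 0 :=
    lie_eq_zero_of_rootSpace_eq_bot (hbot' j (Or.inr rfl)) hf₂ hf₃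
  have hsmul : ∀ (h : H) {χ : Dual ℂ H} {x : 𝔤}, x ∈ rootSpace H χ →
      ⁅(h : 𝔤), x⁆ = χ h • x := fun h _ _ hx => IsKilling.lie_eq_smul_of_mem_rootSpace hx h
  -- `e₂` is a lowest weight vector for the first triple, and `2α_i + α_j` is not a root, so this
  -- Cartan integer is -1.
  have hp : (simpleRoot b j).wt h₁ = -1 :=
    t₁.eq_neg_one_of_lie_lie_eq_zero (hsmul h₁ he₂) (by rw [← lie_skew, e₂f₁, neg_zero]) he₃0 e₁e₃
  have hq : (simpleRoot b i).wt h₂ = -1 :=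
    t₂.eq_neg_one_of_lie_lie_eq_zero (hsmul h₂ he₁) (by rw [← lie_skew, e₁f₂, neg_zero]) he₃0' e₂e₃'
  have hh : ⁅(h₁ : 𝔤), (h₂ : 𝔤)⁆ = 0 := by
    have : ⁅h₁, h₂⁆ = 0 := trivial_lie_zero H H h₁ h₂
    exact congrArg Subtype.val this
  obtain ⟨φ, hφ⟩ := SpecialLinear.exists_lieHom_of_serre (R := ℂ) t₁ t₂ hh
    (by rw [hsmul h₁ he₂, hp, neg_one_smul]) (by rw [hsmul h₂ he₁, hq, neg_one_smul])
    (by rw [hsmul h₁ hf₂, LinearMap.neg_apply, hp, neg_neg, one_smul])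
    (by rw [hsmul h₂ hf₁, LinearMap.neg_apply, hq, neg_neg, one_smul])
    e₁f₂ e₂f₁ e₁e₃ e₂e₃ f₁f₃ f₂f₃
  have h01 : φ (SpecialLinear.single 0 1 (by decide) 1) = e₁ := by
    rw [hφ, SpecialLinear.val_single]; simp
  have h12 : φ (SpecialLinear.single 1 2 (by decide) 1) = e₂ := by
    rw [hφ, SpecialLinear.val_single]; simp
  have h02 : φ (SpecialLinear.single 0 2 (by decide) 1) = ⁅e₁, e₂⁆ := by
    rw [hφ, SpecialLinear.val_single]; simp
  have h10 : φ (SpecialLinear.single 1 0 (by decide) 1) = f₁ := by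
    rw [hφ, SpecialLinear.val_single]; simp
  have h21 : φ (SpecialLinear.single 2 1 (by decide) 1) = f₂ := by
    rw [hφ, SpecialLinear.val_single]; simp
  have h20 : φ (SpecialLinear.single 2 0 (by decide) 1) = ⁅f₂, f₁⁆ := by
    rw [hφ, SpecialLinear.val_single]; simp
  have hinj : Function.Injective φ := by
    refine SpecialLinear.injective_of_single_ne_zero φ fun k l hkl => ?_
    fin_cases k <;> fin_cases l
    · exact (hkl rfl).elim
    · exact h01.trans_ne t₁.e_ne_zero
    · exact h02.trans_ne he₃0
    · exact h10.trans_ne t₁.f_ne_zero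
    · exact (hkl rfl).elim
    · exact h12.trans_ne t₂.e_ne_zero
    · exact h20.trans_ne hf₃0
    · exact h21.trans_ne t₂.f_ne_zero
    · exact (hkl rfl).elim
  have hsurj : Function.Surjective φ := by
    rw [← LieHom.range_eq_top]
    refine eq_top_of_posRoot_mem b (fun β => ?_) (fun β => ?_)
    · rcases hall β with rfl | rfl | rfl
      · exact ⟨e₁, he₁, t₁.e_ne_zero, _, h01⟩
      · exact ⟨e₂, he₂, t₂.e_ne_zero, _, h12⟩
      · exact ⟨_, he₃, he₃0, _, h02⟩
    · rcases hall β with rfl | rfl | rfl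
      · exact ⟨f₁, hf₁, t₁.f_ne_zero, _, h10⟩
      · exact ⟨f₂, hf₂, t₂.f_ne_zero, _, h21⟩
      · exact ⟨_, hf₃, hf₃0, _, h20⟩
  exact ⟨(LieEquiv.ofBijective φ ⟨hinj, hsurj⟩).symm⟩

end MaxNilpotent

end

theorem mainTheorem1 {𝔤 : Type*} [LieRing 𝔤] [LieAlgebra ℂ 𝔤] [FiniteDimensional ℂ 𝔤]
    [LieAlgebra.IsSimple ℂ 𝔤] (H : LieSubalgebra ℂ 𝔤) [H.IsCartanSubalgebra]
    (b : (LieAlgebra.IsKilling.rootSystem H).Base)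
    (e : Module.Basis (MaxNilpotent.PosRoot b) ℂ (MaxNilpotent.nilp b))
    (he : ∀ α, (e α : 𝔤) ∈ LieAlgebra.rootSpace H α.wt)
    (μ : MaxNilpotent.PosRoot b) (hμ : MaxNilpotent.IsMaximalRoot b μ)
    (hsl2 : ¬ Nonempty (𝔤 ≃ₗ⁅ℂ⁆ LieAlgebra.SpecialLinear.sl (Fin 2) ℂ)) :
    Module.finrank ℂ (AdjointCohomology.H1 ℂ (MaxNilpotent.nilp b)) = 2 * Module.finrank ℂ H ∧
    ∃ (hc : ∀ i, MaxNilpotent.c e i ∈ AdjointCohomology.Z1 ℂ (MaxNilpotent.nilp b))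
      (hb : ∀ i, MaxNilpotent.bb e μ i ∈ AdjointCohomology.Z1 ℂ (MaxNilpotent.nilp b)),
      (∃ B : Module.Basis (b.support ⊕ b.support) ℂ
          (AdjointCohomology.H1 ℂ (MaxNilpotent.nilp b)),
        (∀ i, B (Sum.inl i) = AdjointCohomology.cls (MaxNilpotent.c e i) (hc i)) ∧
        (∀ i, B (Sum.inr i) = AdjointCohomology.cls (MaxNilpotent.bb e μ i) (hb i))) ∧
      (∀ j, MaxNilpotent.IsOfWeight
          ((MaxNilpotent.γ μ j).wt - (MaxNilpotent.simpleRoot b j).wt)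
          (MaxNilpotent.bb e μ j)) ∧
      (¬ Nonempty (𝔤 ≃ₗ⁅ℂ⁆ LieAlgebra.SpecialLinear.sl (Fin 3) ℂ) →
        (∀ i j, ⁅AdjointCohomology.cls (MaxNilpotent.c e i) (hc i),
            AdjointCohomology.cls (MaxNilpotent.c e j) (hc j)⁆ = 0) ∧
        (∀ i j, ⁅AdjointCohomology.cls (MaxNilpotent.bb e μ i) (hb i),
            AdjointCohomology.cls (MaxNilpotent.bb e μ j) (hb j)⁆ = 0) ∧
        (∀ i j, ⁅AdjointCohomology.cls (MaxNilpotent.c e i) (hc i),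
            AdjointCohomology.cls (MaxNilpotent.bb e μ j) (hb j)⁆ =
          MaxNilpotent.A b i ((MaxNilpotent.γ μ j).wt - (MaxNilpotent.simpleRoot b j).wt) •
            AdjointCohomology.cls (MaxNilpotent.bb e μ j) (hb j))) := by
  open MaxNilpotent in
  classical
  have hall : (∃ i, μ = simpleRoot b i) → ∀ β, β = μ := by
    rintro ⟨i, hi⟩ β
    have hs : μ.1 ∈ b.support := by rw [hi]; exact i.2
    exact Subtype.ext (hμ.isHighest.eq_of_mem_support hs β.2)
  have hμs : ∀ i, μ ≠ simpleRoot b i := fun i hi =>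
    hsl2 (nonempty_equiv_sl2 μ (hall ⟨i, hi⟩))
  have hc := fun i => c_mem_Z1 he i
  have hb := fun i => bb_mem_Z1 he hμ hμs i
  obtain ⟨E, hE⟩ := exists_equiv_cls_eq_components he hμ hμs
  -- The simple roots form a basis of the dual of the Cartan subalgebra.
  have hdim : Module.finrank ℂ H = Fintype.card b.support := by
    rw [← Subspace.dual_finrank_eq, Module.finrank_eq_card_basis b.toWeightBasis]
  refine ⟨?_, hc, hb, ⟨Module.Basis.ofEquivFun E, fun i => ?_, fun i => ?_⟩,
    fun j => isOfWeight_bb he j, fun hsl3 => ⟨fun i j => ?_, fun i j => ?_, fun i j => ?_⟩⟩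
  · rw [E.finrank_eq, Module.finrank_fintype_fun_eq_card, Fintype.card_sum, hdim, two_mul]
  · rw [Module.Basis.coe_ofEquivFun, LinearEquiv.symm_apply_eq, hE, components_c hμ hμs]
  · rw [Module.Basis.coe_ofEquivFun, LinearEquiv.symm_apply_eq, hE, components_bb hμ hμs]
  · rw [AdjointCohomology.lie_cls, AdjointCohomology.cls_eq_zero_iff]
    exact ⟨0, by rw [lie_c_c, map_zero]⟩
  · refine cls_lie_bb_eq_zero he hμ hμs i j ?_ _ _
    rintro ⟨h1, h2⟩
    have hij : i ≠ j := by
      rintro rfl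
      exact hμ.gamma_ne hμs i h1
    -- The one obstruction to commuting classes: `μ = α_i + α_j` leaves three positive roots, so 𝔤
    -- would be 𝔰𝔩₃.
    have hadd := eq_add_of_gamma_eq hij h1 h2
    refine hsl3 (nonempty_equiv_sl3 hij hadd fun β => ?_)
    have hij' : i.1 ≠ j.1 := fun h => hij (Subtype.ext h)
    exact (hμ.isHighest.eq_or_of_eq_add i.2 j.2 hij' hadd β.2).imp (fun h => Subtype.ext h)
      (Or.imp (fun h => Subtype.ext h) (fun h => Subtype.ext h))
  · rw [AdjointCohomology.lie_cls]
    apply E.injective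
    rw [map_smul, hE, hE, ← map_smul]
    congr 1
    exact Subtype.ext (lie_c_bb i j)
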